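/- **Setting.** Let $\mathcal H=\bigotimes_{k=1}^N\mathcal H_k$ be the state space of a target with $N$ finite-dimensional components, and let the scattered particle have a finite-dimensional state space with an orthonormal basis $\{|f\rangle\}$ containing the incident state $|i\rangle$. A scattering process is a family of unitary S-matrices $S(\alpha)$ (for small $\alpha>0$) on (particle)$\,\otimes\mathcal H$ with $$S(\alpha)=1+i\alpha\sum_{k=1}^N T_k+O(\alpha^2)\qquad(\alpha\to0^+),$$ where $T_k$ acts only on the particle and $\mathcal H_k$. For a density matrix $\rho$ on $\mathcal H$, the target's final state without an incident particle is $\rho_f=\rho$, and with one it is $\rho_f'=\sum_f S_f\rho S_f^\dagger$, $S_f=\langle f|S|i\rangle$. For a unit vector $\psi\in\mathcal H$ put $p_\perp^{i\to i}(\psi)=\langle\psi|S_i^\dagger(1-|\psi\rangle\langle\psi|)S_i|\psi\rangle$. Let $$E_{\rm MF}(\rho)=\inf_{\rho=\sum_\ell p_\ell|\psi_\ell\rangle\langle\psi_\ell|}\ \sum_\ell p_\ell\,\frac1N\sum_{k=1}^N s_k(\psi_\ell),$$ over finite decompositions into pure states, with $s_k(\psi)$ the von Neumann entropy (natural logarithm)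 of the reduced state of $|\psi\rangle\langle\psi|$ on $\mathcal H_k$. Write $T_k^{i\to f}=\langle f|T_k|i\rangle$. A test is an operator $0\le M\le 1$ on $\mathcal H$ (the "positive" element of a two-outcome POVM); its signal is $\Delta_M(\alpha)={\rm Tr}[M\rho_f'(\alpha)]-{\rm Tr}[M\rho_f]$. Fix a type I error $\epsilon$ and a power $\pi$ with $\epsilon<\pi$. A coupling $\alpha>0$ is *detectable at order $\alpha^n$* if there is a test $M$ with leading signal $\Delta_M(\beta)=a\beta^n+o(\beta^n)$ as $\beta\to0^+$, such that ${\rm Tr}[M\rho_f]\le\epsilon$ and ${\rm Tr}[M\rho_f]+a\alpha^n\ge\pi$. Let $\alpha_{\min}^{(n)}\in[0,\infty]$ be the infimum of the couplings detectable at order $\alpha^n$ ($\infty$ if there are none, in which case $1/\alpha_{\min}^2=0$). **Lemma.** Let $B$ be a constant such that the leading-order orthogonal scattering probability off each single component, in any pure state $\varphi$ of $\mathcal H_k$, is at most $B\alpha^2$: $\sum_f\langle\varphi|(T_k^{i\to f})^\dagger(1-|\varphi\rangle\langle\varphi|)T_k^{i\to f}|\varphi\rangle\le B$ for all $k$ and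 $\varphi$. 1. For every test, $\Delta_M(\alpha)=a\alpha+O(\alpha^2)$ for some real $a$, and $$\frac1{(\alpha_{\min}^{(1)})^2}\le C\left(N+N^2\sqrt{E_{\rm MF}(\rho)}\right),$$ where $C$ depends only on $\pi,\epsilon,B$. 2. Let moreover $B'$ be a constant such that $\sum_{f\ne i}\|T_k^{i\to f}\varphi\|^2\le B'$ for all $k$ and all unit $\varphi\in\mathcal H_k$ (the leading-order probability of scattering off a single component into an outgoing particle state other than $|i\rangle$ is at most $B'\alpha^2$). Suppose that $p_\perp^{i\to i}(\psi)=0$ for all sufficiently small $\alpha>0$, for every pure-state component $\psi$ of $\rho$ (i.e. every $\psi$ that occurs with positive weight in some decomposition of $\rho$). Then no test has an effect below second order, $\Delta_M(\alpha)=O(\alpha^2)$, and indeed $\Delta_M(\alpha)=a\alpha^2+O(\alpha^3)$ for some real $a$; and at that order $$\frac1{(\alpha_{\min}^{(2)})^2}\le C\left(N^{3/2}+N^2E_{\rm MF}(\rho)^{1/4}\right),$$ where $C$ depends only on $\pi,\epsilon,B,B'$. If $p_\perp^{i\to i}=0$, for all sufficiently small $\alpha>0$, is assumed only for the components of positive weight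 of one decomposition $\rho=\sum_\ell p_\ell|\psi_\ell\rangle\langle\psi_\ell|$, the same conclusions hold with $E_{\rm MF}(\rho)$ replaced by that decomposition's average entropy $\sum_\ell p_\ell\frac1N\sum_k s_k(\psi_\ell)$. -/

import Mathlib

open Filter Topology Asymptotics
open scoped Matrix ENNReal ComplexOrder

noncomputable section

/-- Index set of the product basis of the target space `⨂ₖ ℂ^(d k)`: matrices indexed by
`TargetIdx d` are the operators on the target, functions `TargetIdx d → ℂ` its vectors. -/
abbrev TargetIdx {N : ℕ} (d : Fin N → ℕ) : Type := (k : Fin N) → Fin (d k)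

/-- The rank-one operator `|ψ⟩⟨ψ|`. -/
def ketBra {n : Type} (ψ : n → ℂ) : Matrix n n ℂ := Matrix.vecMulVec ψ (star ψ)

/-- `ψ` is a unit vector for the Hermitian inner product. -/
def IsUnitVec {n : Type} [Fintype n] (ψ : n → ℂ) : Prop := ∑ x, ‖ψ x‖ ^ 2 = 1

/-- Density matrices: positive semidefinite, trace one. -/
def IsDensity {n : Type} [Fintype n] (ρ : Matrix n n ℂ) : Prop :=
  ρ.PosSemidef ∧ ρ.trace = 1

/-- A test on the target, i.e. the "positive" element `M` of a two-outcome POVM `{M, 1 - M}`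
(any POVM followed by a possibly randomised decision rule is of this form). -/
def IsTest {n : Type} [Fintype n] [DecidableEq n] (M : Matrix n n ℂ) : Prop :=
  M.PosSemidef ∧ (1 - M).PosSemidef

/-- The orthogonal weight `⟨ψ| A† (1 - |ψ⟩⟨ψ|) A |ψ⟩`. -/
def orthWeight {n : Type} [Fintype n] [DecidableEq n] (A : Matrix n n ℂ) (ψ : n → ℂ) : ℝ :=
  (star ψ ⬝ᵥ ((Aᴴ * (1 - ketBra ψ) * A) *ᵥ ψ)).re

/-! ### Reduced states and entropies -/

/-- Reduced matrix on the `k`-th factor: `(ρ_k)_{ab} = ∑ ρ_{(a, r), (b, r)}`, the sum being over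
the configurations `r` of the other factors. -/
def reduced {N : ℕ} {d : Fin N → ℕ} (ρ : Matrix (TargetIdx d) (TargetIdx d) ℂ) (k : Fin N) :
    Matrix (Fin (d k)) (Fin (d k)) ℂ :=
  fun a b => ∑ x : TargetIdx d, if x k = a then ρ x (Function.update x k b) else 0

theorem reduced_isHermitian {N : ℕ} {d : Fin N → ℕ}
    {ρ : Matrix (TargetIdx d) (TargetIdx d) ℂ} (h : ρ.IsHermitian) (k : Fin N) :
    (reduced ρ k).IsHermitian := by
  ext a b
  simp only [Matrix.conjTranspose_apply, reduced, star_sum]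
  rw [← Finset.sum_filter_add_sum_filter_not Finset.univ (fun x : TargetIdx d => x k = b),
    ← Finset.sum_filter_add_sum_filter_not (f := fun x : TargetIdx d =>
      if x k = a then ρ x (Function.update x k b) else 0)
      Finset.univ (fun x : TargetIdx d => x k = a)]
  congr 1
  · refine Finset.sum_bij' (fun x _ => Function.update x k a) (fun x _ => Function.update x k b)
      ?_ ?_ ?_ ?_ ?_
    · intro x _; simp
    · intro x _; simp
    · intro x hx
      have hx' : x k = b := by simpa using hx
      subst hx'; simp
    · intro x hx
      have hx' : x k = a := by simpa using hx
      subst hx'; simp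
    · intro x hx
      have hx' : x k = b := by simpa using hx
      subst hx'
      simp [h.apply]
  · rw [Finset.sum_eq_zero, Finset.sum_eq_zero]
    · intro x hx
      have hx' : ¬ x k = a := by simpa using hx
      simp [hx']
    · intro x hx
      have hx' : ¬ x k = b := by simpa using hx
      simp [hx']

theorem ketBra_isHermitian {n : Type} (ψ : n → ℂ) : (ketBra ψ).IsHermitian := by
  ext a b
  simp [ketBra, Matrix.vecMulVec_apply, mul_comm]

/-- von Neumann entropy `-Tr[A ln A]`, as the sum of `-λ ln λ` over the eigenvalues. -/
def vnEntropy {n : Type} [Fintype n] [DecidableEq n] {A : Matrix n n ℂ} (hA : A.IsHermitian) : ℝ :=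
  ∑ i, Real.negMulLog (hA.eigenvalues i)

/-- Entropy `s_k` of the `k`-th factor in the pure state `|ψ⟩⟨ψ|`. -/
def siteEntropy {N : ℕ} {d : Fin N → ℕ} (ψ : TargetIdx d → ℂ) (k : Fin N) : ℝ :=
  vnEntropy (reduced_isHermitian (ketBra_isHermitian ψ) k)

/-- A decomposition `ρ = ∑_ℓ p_ℓ |ψ_ℓ⟩⟨ψ_ℓ|` into finitely many pure states. -/
structure PureDecomposition {N : ℕ} {d : Fin N → ℕ}
    (ρ : Matrix (TargetIdx d) (TargetIdx d) ℂ) where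
  size : ℕ
  p : Fin size → ℝ
  ψ : Fin size → TargetIdx d → ℂ
  p_nonneg : ∀ l, 0 ≤ p l
  p_sum : ∑ l, p l = 1
  unit : ∀ l, IsUnitVec (ψ l)
  eq_sum : ρ = ∑ l, (p l : ℂ) • ketBra (ψ l)

/-- `∑_ℓ p_ℓ Avg_k s_{k,ℓ}`. -/
def PureDecomposition.avgEntropy {N : ℕ} {d : Fin N → ℕ}
    {ρ : Matrix (TargetIdx d) (TargetIdx d) ℂ} (D : PureDecomposition ρ) : ℝ :=
  ∑ l, D.p l * ((∑ k, siteEntropy (D.ψ l) k) / N)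

/-- The multipartite entanglement of formation `E_MF`. -/
def entanglementMF {N : ℕ} {d : Fin N → ℕ} (ρ : Matrix (TargetIdx d) (TargetIdx d) ℂ) : ℝ :=
  ⨅ D : PureDecomposition ρ, D.avgEntropy

/-! ### Scattering -/

/-- An operator on (scattered particle) ⊗ (`k`-th factor), extended to the whole space by the
identity on the other factors. -/
def embed {N m : ℕ} {d : Fin N → ℕ} (k : Fin N)
    (A : Matrix (Fin m × Fin (d k)) (Fin m × Fin (d k)) ℂ) :
    Matrix (Fin m × TargetIdx d) (Fin m × TargetIdx d) ℂ :=
  fun x y => if ∀ j, j ≠ k → x.2 j = y.2 j then A (x.1, x.2 k) (y.1, y.2 k) else 0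

/-- A scattering process for one incident particle on an `N`-component target. The scattered
particle has state space `ℂ^m` with an orthonormal basis `|f⟩`, `f : Fin m`, that contains the
incident state `|i⟩`; `S α` is the S-matrix at coupling `α`. -/
structure ScatteringProcess (N m : ℕ) (d : Fin N → ℕ) where
  i : Fin m
  S : ℝ → Matrix (Fin m × TargetIdx d) (Fin m × TargetIdx d) ℂ
  T : (k : Fin N) → Matrix (Fin m × Fin (d k)) (Fin m × Fin (d k)) ℂ
  unitary : ∀ᶠ α in 𝓝[>] (0 : ℝ), S α ∈ Matrix.unitaryGroup (Fin m × TargetIdx d) ℂ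
  /-- `S = 1 + i α ∑ₖ Tₖ + O(α²)` as `α → 0⁺`, entry by entry. -/
  expansion : ∀ x y, (fun α : ℝ =>
      (S α - 1 - (Complex.I * (α : ℂ)) • ∑ k, embed k (T k)) x y)
    =O[𝓝[>] (0 : ℝ)] fun α => α ^ 2

namespace ScatteringProcess

variable {N m : ℕ} {d : Fin N → ℕ} (P : ScatteringProcess N m d)

/-- `S_f = ⟨f| S |i⟩`, an operator on the target. -/
def kraus (α : ℝ) (f : Fin m) : Matrix (TargetIdx d) (TargetIdx d) ℂ :=
  fun x y => P.S α (f, x) (P.i, y)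

/-- `T_k^{i → f} = ⟨f| T_k |i⟩`, an operator on the `k`-th factor. -/
def singleT (k : Fin N) (f : Fin m) : Matrix (Fin (d k)) (Fin (d k)) ℂ :=
  fun a b => P.T k (f, a) (P.i, b)

/-- State `ρ_f'` of the target after an incident particle: the partial trace of
`S (|i⟩⟨i| ⊗ ρ) S†` over the outgoing particle. In the absence of an incident particle the
target stays in the state `ρ` (interaction picture). -/
def finalState (ρ : Matrix (TargetIdx d) (TargetIdx d) ℂ) (α : ℝ) :
    Matrix (TargetIdx d) (TargetIdx d) ℂ :=
  ∑ f, P.kraus α f * ρ * (P.kraus α f)ᴴ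

/-- `p_⊥^{i → f}` for the pure target state `ψ`. -/
def pPerp (α : ℝ) (f : Fin m) (ψ : TargetIdx d → ℂ) : ℝ := orthWeight (P.kraus α f) ψ

/-- `p_{⊥,k}^max / α² ≤ B` at leading order, for every `k`: scattering off the `k`-th component
alone, prepared in any state `φ`, has orthogonal scattering probability at most `B α²`. -/
def SinglePerpBound (B : ℝ) : Prop :=
  ∀ (k : Fin N) (φ : Fin (d k) → ℂ), IsUnitVec φ → ∑ f, orthWeight (P.singleT k f) φ ≤ B

/-- At leading order, scattering off the `k`-th component alone, prepared in any state `φ`, has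
total probability at most `B α²` for outgoing particle states other than the incident one. -/
def SingleScatterBound (B : ℝ) : Prop :=
  ∀ (k : Fin N) (φ : Fin (d k) → ℂ), IsUnitVec φ →
    ∑ f ∈ Finset.univ.erase P.i, ∑ a, ‖(P.singleT k f *ᵥ φ) a‖ ^ 2 ≤ B

/-- `Tr[M ρ_f'] - Tr[M ρ_f]`: probability of a positive result with an incident particle, minus
the one without. -/
def signal (ρ M : Matrix (TargetIdx d) (TargetIdx d) ℂ) (α : ℝ) : ℝ :=
  (M * P.finalState ρ α).trace.re - (M * ρ).trace.re

/-- The coupling `α` is detectable at order `α ^ n` with the given power and type I error: some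
test has leading signal `a α ^ n` (no effect of lower order), type I error at most `ε`, and at
this order power at least `power`. -/
def Detectable (ρ : Matrix (TargetIdx d) (TargetIdx d) ℂ) (power ε : ℝ) (n : ℕ) (α : ℝ) : Prop :=
  ∃ (M : Matrix (TargetIdx d) (TargetIdx d) ℂ) (a : ℝ), IsTest M ∧
    (fun β : ℝ => P.signal ρ M β - a * β ^ n) =o[𝓝[>] (0 : ℝ)] (fun β => β ^ n) ∧
    (M * ρ).trace.re ≤ ε ∧ power ≤ (M * ρ).trace.re + a * α ^ n

/-- Detection limit `α_min` at order `α ^ n` over all tests (`∞` if nothing is detectable). -/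
def alphaMin (ρ : Matrix (TargetIdx d) (TargetIdx d) ℂ) (power ε : ℝ) (n : ℕ) : ℝ≥0∞ :=
  ⨅ (α : ℝ) (_ : 0 < α ∧ P.Detectable ρ power ε n α), ENNReal.ofReal α

/-- `p_⊥^{i → i} = 0`, for all small enough `α > 0`, for each pure state that occurs in `D`. -/
def NoForward {ρ : Matrix (TargetIdx d) (TargetIdx d) ℂ} (D : PureDecomposition ρ) : Prop :=
  ∀ l, 0 < D.p l → ∀ᶠ α in 𝓝[>] (0 : ℝ), P.pPerp α P.i (D.ψ l) = 0

/-- No test sees an effect below order `α²`, and every test has a well-defined effect at that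
order. -/
def EffectIsSecondOrder (ρ : Matrix (TargetIdx d) (TargetIdx d) ℂ) : Prop :=
  ∀ M, IsTest M →
    (fun α : ℝ => P.signal ρ M α) =O[𝓝[>] (0 : ℝ)] (fun α => α ^ 2) ∧
    ∃ a : ℝ, (fun α : ℝ => P.signal ρ M α - a * α ^ 2) =O[𝓝[>] (0 : ℝ)] fun α => α ^ 3

end ScatteringProcess

end

/-! The action of a test on ψ is governed by the vectors T_f ψ = ∑ₖ T_k^{i→f} ψ, and multiples of ψ
in them have no effect at leading order. The quantity to bound is therefore ∑_f ‖T_f ψ - h_f ψ‖² for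
well-chosen scalars h_f.

At each site let φ_k be a dominant eigenvector of the reduced state and P_k the projection of site k
onto it; then ‖ψ - P_k ψ‖² ≤ s_k, because the entropy is at least 1 - λ_max. Put A_{k,f} = T_k^{i→f}
- ⟨φ_k|T_k^{i→f}|φ_k⟩. The variance bound B in every pure state forces ∑_f ‖A_{k,f} v‖² ≤ 40 B ‖v‖².
Since P_k A_{k,f} P_k = 0 and P_k commutes with A_{l,f} for l ≠ k, a cross term ⟨A_{k,f} ψ, A_{l,f}
ψ⟩ would vanish on the range of P_k; summed over f it is O(B √s_k). The N diagonal terms give O(BN)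
and the cross terms O(B N² √Avg s) (`SinglePerpBound.exists_sum_norm_sub_smul_sq_le`).

At order α only the forward channel contributes, and unitarity cancels its component along ψ, so the
coefficient is at most 4 ‖T_i ψ - h_i ψ‖ (`abs_coeffOne_le`). Squaring gives N + N² √E. If the
forward channel fixes ψ up to a scalar, normalisation turns the signal into a sum over f ≠ i of
terms that start at order α². Their scalar parts cancel again, leaving x² + xy up to constants, with
x² the sum above and y² ≤ B' N² (`coeffTwo_le`); this gives N^{3/2} + N² E^{1/4}.

Jensen's inequality averages these bounds over a decomposition, and continuity passes to the infimum
`entanglementMF`. -/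

section Hilbert

/-! ### Hilbert space estimates: variances and sums of nearly uncorrelated vectors. -/

variable {E : Type*} [NormedAddCommGroup E] [InnerProductSpace ℂ E]

theorem norm_sub_inner_smul_sq {χ : E} (h : ‖χ‖ = 1) (x : E) :
    ‖x - inner ℂ χ x • χ‖ ^ 2 = ‖x‖ ^ 2 - ‖inner ℂ χ x‖ ^ 2 := by
  rw [@norm_sub_sq ℂ, inner_smul_right, norm_smul, h, mul_one, ← inner_conj_symm x χ,
    RCLike.mul_conj, ← RCLike.ofReal_pow, RCLike.ofReal_re]
  ring

theorem norm_inner_sq_le_of_orthogonal {χ ζ : E} (h : ‖χ‖ = 1) (hz : ‖ζ‖ = 1)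
    (ho : inner ℂ ζ χ = 0) (x : E) :
    ‖inner ℂ ζ x‖ ^ 2 ≤ ‖x‖ ^ 2 - ‖inner ℂ χ x‖ ^ 2 := by
  rw [← norm_sub_inner_smul_sq h]
  have h1 : inner ℂ ζ x = inner ℂ ζ (x - inner ℂ χ x • χ) := by
    rw [inner_sub_right, inner_smul_right, ho]; simp
  rw [h1]
  have := norm_inner_le_norm (𝕜 := ℂ) ζ (x - inner ℂ χ x • χ)
  rw [hz, one_mul] at this
  gcongr

theorem norm_add_sq_le_two {E : Type*} [SeminormedAddCommGroup E] (a b : E) : ‖a + b‖ ^ 2 ≤ 2 * ‖a‖ ^ 2 + 2 * ‖b‖ ^ 2 := by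
  have := norm_add_le a b
  have h2 : ‖a + b‖ ^ 2 ≤ (‖a‖ + ‖b‖) ^ 2 := by gcongr
  nlinarith [sq_nonneg (‖a‖ - ‖b‖)]

variable {F : Type*}

/-- If the total variance of a family of operators is at most `B` in every pure state, then the
family is within `√(40 B)` of a family of scalars, which may be taken to be the means in any one
pure state. -/
theorem sum_norm_sub_mean_sq_le [Fintype F] (A : F → E →ₗ[ℂ] E) {B : ℝ}
    (hB : ∀ φ : E, ‖φ‖ = 1 → ∑ f, (‖A f φ‖ ^ 2 - ‖inner ℂ φ (A f φ)‖ ^ 2) ≤ B)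
    {φ₀ : E} (h₀ : ‖φ₀‖ = 1) (v : E) :
    ∑ f, ‖A f v - inner ℂ φ₀ (A f φ₀) • v‖ ^ 2 ≤ 40 * B * ‖v‖ ^ 2 := by
  -- A variance is the squared norm of the part of A φ orthogonal to φ, so it dominates every
  -- off-diagonal matrix element.
  have hoff : ∀ φ ζ : E, ‖φ‖ = 1 → ‖ζ‖ = 1 → inner ℂ ζ φ = 0 →
      ∑ f, ‖inner ℂ ζ (A f φ)‖ ^ 2 ≤ B := fun φ ζ hφ hζ ho =>
    (Finset.sum_le_sum fun f _ => norm_inner_sq_le_of_orthogonal hφ hζ ho (A f φ)).trans (hB φ hφ)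
  have hB0 : 0 ≤ B := (Finset.sum_nonneg fun f _ => by
    rw [← norm_sub_inner_smul_sq h₀]; positivity).trans (hB φ₀ h₀)
  set A' : F → E →ₗ[ℂ] E := fun f => A f - inner ℂ φ₀ (A f φ₀) • LinearMap.id with hA'
  have hA'v : ∀ f v, A' f v = A f v - inner ℂ φ₀ (A f φ₀) • v := fun f v => by simp [hA']
  simp only [← hA'v]
  have hzero : ∀ f, inner ℂ φ₀ (A' f φ₀) = 0 := fun f => by
    rw [hA'v, inner_sub_right, inner_smul_right, inner_self_eq_norm_sq_to_K, h₀]; simp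
  have hbase : ∑ f, ‖A' f φ₀‖ ^ 2 ≤ B := by
    simp only [hA'v, norm_sub_inner_smul_sq h₀]; exact hB φ₀ h₀
  have hA'o : ∀ φ ζ : E, inner ℂ ζ φ = 0 → ∀ f, inner ℂ ζ (A' f φ) = inner ℂ ζ (A f φ) :=
    fun φ ζ ho f => by rw [hA'v, inner_sub_right, inner_smul_right, ho]; simp
  have hunit : ∀ φ : E, ‖φ‖ = 1 → inner ℂ φ₀ φ = 0 → ∑ f, ‖A' f φ‖ ^ 2 ≤ 19 * B := by
    intro φ hφ ho
    have ho' : inner ℂ φ φ₀ = 0 := by rw [← inner_conj_symm, ho]; simp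
    set c : ℂ := (((√2)⁻¹ : ℝ) : ℂ) with hc
    have hc2 : (starRingEnd ℂ) c * c = 1 / 2 := by
      rw [hc, Complex.conj_ofReal, ← Complex.ofReal_mul, ← mul_inv, Real.mul_self_sqrt (by norm_num)]
      norm_num
    have hcn : ‖c‖ ^ 2 = 1 / 2 := by
      rw [hc, Complex.norm_real, Real.norm_eq_abs, sq_abs, inv_pow, Real.sq_sqrt (by norm_num)]
      norm_num
    have hi0 : inner ℂ φ₀ φ₀ = (1 : ℂ) := by rw [inner_self_eq_norm_sq_to_K, h₀]; simp
    have hi1 : inner ℂ φ φ = (1 : ℂ) := by rw [inner_self_eq_norm_sq_to_K, hφ]; simp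
    have hn : ∀ s : ℂ, ‖s‖ = 1 → ‖c • (φ + s • φ₀)‖ = 1 := by
      intro s hs
      have : ‖c • (φ + s • φ₀)‖ ^ 2 = 1 := by
        rw [norm_smul, mul_pow, hcn, @norm_add_sq ℂ, inner_smul_right, ho', norm_smul, hφ, h₀, hs]
        norm_num
      exact (pow_eq_one_iff_of_nonneg (norm_nonneg _) two_ne_zero).1 this
    have hor : inner ℂ (c • (φ + (-1 : ℂ) • φ₀)) (c • (φ + (1 : ℂ) • φ₀)) = (0 : ℂ) := by
      simp only [inner_smul_left, inner_smul_right, inner_add_left, inner_add_right, ho, ho', hi0,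
        hi1]
      simp
    have h3 := hoff _ _ (hn 1 (by simp)) (hn (-1) (by simp)) hor
    have h1 := hoff φ φ₀ hφ h₀ ho
    have h2 := hoff φ₀ φ h₀ hφ ho'
    -- A diagonal element is made of off-diagonal ones: as A' has mean 0 in φ₀, expanding the
    -- element x between (φ - φ₀)/√2 and (φ + φ₀)/√2 gives ⟨φ, A'φ⟩ = 2x + ⟨φ₀, A'φ⟩ - ⟨φ, A'φ₀⟩.
    -- Hence 3(4 + 1 + 1)B = 18B, and the variance in φ adds B.
    have key : ∀ f, ‖inner ℂ φ (A' f φ)‖ ^ 2 ≤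
        3 * (4 * ‖inner ℂ (c • (φ + (-1 : ℂ) • φ₀)) (A f (c • (φ + (1 : ℂ) • φ₀)))‖ ^ 2 +
          ‖inner ℂ φ₀ (A f φ)‖ ^ 2 + ‖inner ℂ φ (A f φ₀)‖ ^ 2) := by
      intro f
      rw [← hA'o _ _ hor, ← hA'o _ _ ho, ← hA'o _ _ ho']
      set x := inner ℂ (c • (φ + (-1 : ℂ) • φ₀)) (A' f (c • (φ + (1 : ℂ) • φ₀))) with hx
      have e : inner ℂ φ (A' f φ) = 2 * x + inner ℂ φ₀ (A' f φ) - inner ℂ φ (A' f φ₀) := by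
        rw [hx]
        simp only [map_smul, map_add, inner_smul_left, inner_smul_right, inner_add_left,
          inner_add_right, hzero, map_neg, map_one]
        linear_combination (-2) * (inner ℂ φ (A' f φ) - inner ℂ φ₀ (A' f φ)
          + inner ℂ φ (A' f φ₀)) * hc2
      rw [e]
      have t1 := norm_sub_le (2 * x + inner ℂ φ₀ (A' f φ)) (inner ℂ φ (A' f φ₀))
      have t2 := norm_add_le (2 * x) (inner ℂ φ₀ (A' f φ))
      have t3 : ‖2 * x‖ = 2 * ‖x‖ := by simp
      rw [t3] at t2
      have t4 := t1.trans (add_le_add_left t2 _)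
      have t5 := pow_le_pow_left₀ (norm_nonneg _) t4 2
      refine t5.trans ?_
      nlinarith [sq_nonneg (2 * ‖x‖ - ‖inner ℂ φ₀ (A' f φ)‖),
        sq_nonneg (2 * ‖x‖ - ‖inner ℂ φ (A' f φ₀)‖),
        sq_nonneg (‖inner ℂ φ₀ (A' f φ)‖ - ‖inner ℂ φ (A' f φ₀)‖)]
    have key2 := Finset.sum_le_sum fun f (_ : f ∈ Finset.univ) => key f
    simp only [← Finset.mul_sum, Finset.sum_add_distrib] at key2
    have key3 : ∀ f, ‖A' f φ‖ ^ 2 =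
        (‖A f φ‖ ^ 2 - ‖inner ℂ φ (A f φ)‖ ^ 2) + ‖inner ℂ φ (A' f φ)‖ ^ 2 := by
      intro f
      rw [← norm_sub_inner_smul_sq hφ, ← sub_eq_iff_eq_add, ← norm_sub_inner_smul_sq hφ]
      congr 2
      rw [hA'v, inner_sub_right, inner_smul_right, hi1, mul_one, sub_smul]
      abel
    simp only [key3, Finset.sum_add_distrib]
    have := hB φ hφ
    linarith
  have horth : ∀ w : E, inner ℂ φ₀ w = 0 → ∑ f, ‖A' f w‖ ^ 2 ≤ 19 * B * ‖w‖ ^ 2 := by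
    intro w hw
    by_cases h : w = 0
    · simp [h]
    have hw0 : ‖w‖ ≠ 0 := norm_ne_zero_iff.2 h
    have := hunit (((‖w‖⁻¹ : ℝ) : ℂ) • w) (by
      rw [norm_smul, Complex.norm_real, Real.norm_eq_abs, abs_inv, abs_norm, inv_mul_cancel₀ hw0])
      (by rw [inner_smul_right, hw, mul_zero])
    simp only [map_smul, norm_smul, Complex.norm_real, Real.norm_eq_abs, abs_inv, abs_norm,
      mul_pow, ← Finset.mul_sum, inv_pow] at this
    rwa [inv_mul_le_iff₀ (by positivity), mul_comm] at this
  set s := inner ℂ φ₀ v with hs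
  have hw : inner ℂ φ₀ (v - s • φ₀) = 0 := by
    rw [inner_sub_right, inner_smul_right, inner_self_eq_norm_sq_to_K, h₀]; simp [hs]
  have h5 := horth _ hw
  rw [norm_sub_inner_smul_sq h₀] at h5
  have hle : ∀ f, ‖A' f v‖ ^ 2 ≤ 2 * (‖s‖ ^ 2 * ‖A' f φ₀‖ ^ 2) + 2 * ‖A' f (v - s • φ₀)‖ ^ 2 := by
    intro f
    have := norm_add_sq_le_two (A' f (s • φ₀)) (A' f (v - s • φ₀))
    rw [← map_add, add_sub_cancel, map_smul, norm_smul, mul_pow] at this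
    exact this
  have h6 := Finset.sum_le_sum fun f (_ : f ∈ Finset.univ) => hle f
  simp only [← Finset.mul_sum, Finset.sum_add_distrib] at h6
  have h7 : ‖s‖ ^ 2 * ∑ f, ‖A' f φ₀‖ ^ 2 ≤ ‖s‖ ^ 2 * B := by gcongr
  have h8 : 0 ≤ B * ‖s‖ ^ 2 := by positivity
  have h9 : 0 ≤ B * ‖v‖ ^ 2 := by positivity
  nlinarith

theorem abs_sum_re_inner_le (s : Finset F) (u v : F → E) {K a b : ℝ} (ha : 0 ≤ a) (hb : 0 ≤ b)
    (hK : 0 ≤ K) (hu : ∑ f ∈ s, ‖u f‖ ^ 2 ≤ K * a ^ 2) (hv : ∑ f ∈ s, ‖v f‖ ^ 2 ≤ K * b ^ 2) :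
    |∑ f ∈ s, (inner ℂ (u f) (v f)).re| ≤ K * a * b := by
  calc |∑ f ∈ s, (inner ℂ (u f) (v f)).re| ≤ ∑ f ∈ s, ‖u f‖ * ‖v f‖ :=
        (Finset.abs_sum_le_sum_abs _ _).trans (Finset.sum_le_sum fun f _ =>
          (Complex.abs_re_le_norm _).trans (norm_inner_le_norm _ _))
    _ ≤ √(∑ f ∈ s, ‖u f‖ ^ 2) * √(∑ f ∈ s, ‖v f‖ ^ 2) := Real.sum_mul_le_sqrt_mul_sqrt _ _ _
    _ ≤ √(K * a ^ 2) * √(K * b ^ 2) := by gcongr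
    _ = K * a * b := by
        rw [← Real.sqrt_mul (by positivity),
          show K * a ^ 2 * (K * b ^ 2) = (K * a * b) ^ 2 by ring, Real.sqrt_sq (by positivity)]

/-- On the range of P the inner product is exactly 0: A' lets P through, P moves to the other side,
and P A P = 0. Replacing ψ by P ψ in one slot at a time costs K ‖ψ - P ψ‖ each. -/
theorem abs_sum_re_inner_le_of_commute [Fintype F] (A A' : F → E →L[ℂ] E) (P : E →L[ℂ] E) {K : ℝ} (hK : 0 ≤ K)
    (hA : ∀ v, ∑ f, ‖A f v‖ ^ 2 ≤ K * ‖v‖ ^ 2) (hA' : ∀ v, ∑ f, ‖A' f v‖ ^ 2 ≤ K * ‖v‖ ^ 2)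
    (hsymm : ∀ u v, inner ℂ (P u) v = inner ℂ u (P v)) (hPn : ∀ v, ‖P v‖ ≤ ‖v‖)
    (hzero : ∀ f v, P (A f (P v)) = 0) (hcomm : ∀ f v, P (A' f v) = A' f (P v))
    {ψ : E} (hψ : ‖ψ‖ = 1) :
    |∑ f, (inner ℂ (A f ψ) (A' f ψ)).re| ≤ 2 * K * ‖ψ - P ψ‖ := by
  have key : ∀ f, (inner ℂ (A f ψ) (A' f ψ)).re =
      (inner ℂ (A f (ψ - P ψ)) (A' f ψ)).re + (inner ℂ (A f (P ψ)) (A' f (ψ - P ψ))).re := by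
    intro f
    have h0 : inner ℂ (A f (P ψ)) (A' f (P ψ)) = 0 := by
      rw [← hcomm, ← hsymm, hzero, inner_zero_left]
    rw [← Complex.add_re]
    congr 1
    simp only [map_sub, inner_sub_left, inner_sub_right, h0]
    ring
  simp only [key, Finset.sum_add_distrib]
  have hP1 : ‖P ψ‖ ≤ 1 := (hPn ψ).trans_eq hψ
  have h1 := abs_sum_re_inner_le Finset.univ (fun f => A f (ψ - P ψ)) (fun f => A' f ψ)
    (norm_nonneg _) (norm_nonneg _) hK (hA _) (hA' _)
  have h2 := abs_sum_re_inner_le Finset.univ (fun f => A f (P ψ)) (fun f => A' f (ψ - P ψ))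
    (norm_nonneg _) (norm_nonneg _) hK (hA _) (hA' _)
  rw [hψ] at h1
  have h3 : K * ‖P ψ‖ * ‖ψ - P ψ‖ ≤ K * 1 * ‖ψ - P ψ‖ := by gcongr
  refine (abs_add_le _ _).trans ?_
  linarith

theorem sum_norm_sum_sq_eq {κ : Type*} [Fintype κ] (s : Finset F) (u : κ → F → E) :
    ∑ f ∈ s, ‖∑ k, u k f‖ ^ 2 = ∑ k, ∑ l, ∑ f ∈ s, (inner ℂ (u k f) (u l f)).re := by
  have : ∀ f, ‖∑ k, u k f‖ ^ 2 = ∑ k, ∑ l, (inner ℂ (u k f) (u l f)).re := by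
    intro f
    rw [← @inner_self_eq_norm_sq ℂ, sum_inner]
    simp only [inner_sum, map_sum, RCLike.re_to_complex]
  simp only [this]
  rw [Finset.sum_comm]
  exact Finset.sum_congr rfl fun k _ => Finset.sum_comm

/-- Total weight of `∑ₖ A_{k,f} ψ` when the `A_{k,f}` have vanishing compressions to commuting
projections close to the identity at `ψ`. -/
theorem sum_norm_sum_sq_le [Fintype F] {κ : Type*} [Fintype κ] [DecidableEq κ] (A : κ → F → E →L[ℂ] E)
    (P : κ → E →L[ℂ] E) {K : ℝ} (hK : 0 ≤ K)
    (hA : ∀ k v, ∑ f, ‖A k f v‖ ^ 2 ≤ K * ‖v‖ ^ 2)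
    (hsymm : ∀ k u v, inner ℂ (P k u) v = inner ℂ u (P k v)) (hPn : ∀ k v, ‖P k v‖ ≤ ‖v‖)
    (hzero : ∀ k f v, P k (A k f (P k v)) = 0)
    (hcomm : ∀ k l, l ≠ k → ∀ f v, P k (A l f v) = A l f (P k v))
    {ψ : E} (hψ : ‖ψ‖ = 1) :
    ∑ f, ‖∑ k, A k f ψ‖ ^ 2 ≤
      K * (Fintype.card κ + 2 * Fintype.card κ * ∑ k, ‖ψ - P k ψ‖) := by
  rw [sum_norm_sum_sq_eq]
  have hkl : ∀ k l, ∑ f, (inner ℂ (A k f ψ) (A l f ψ)).re ≤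
      (if l = k then K else 0) + 2 * K * ‖ψ - P k ψ‖ := by
    intro k l
    by_cases h : l = k
    · subst h
      have : ∑ f, (inner ℂ (A l f ψ) (A l f ψ)).re ≤ K := by
        have := hA l ψ
        rw [hψ, one_pow, mul_one] at this
        refine le_trans (le_of_eq ?_) this
        exact Finset.sum_congr rfl fun f _ => @inner_self_eq_norm_sq ℂ _ _ _ _ _
      have h2 : 0 ≤ 2 * K * ‖ψ - P l ψ‖ := by positivity
      simp only [if_true]; linarith
    · rw [if_neg h, zero_add]
      exact (le_abs_self _).trans (abs_sum_re_inner_le_of_commute _ _ (P k) hK (hA k) (hA l)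
        (hsymm k) (hPn k) (hzero k) (hcomm k l h) hψ)
  refine (Finset.sum_le_sum fun k _ => Finset.sum_le_sum fun l _ => hkl k l).trans (le_of_eq ?_)
  simp [Finset.sum_add_distrib, ← Finset.mul_sum]
  ring

/-- The estimate by Cauchy–Schwarz alone, which ignores how correlated the summands are. -/
theorem sum_norm_sum_sq_le_card_sq {κ : Type*} [Fintype κ] (s : Finset F) (u : κ → F → E) {K : ℝ}
    (hK : 0 ≤ K) (hu : ∀ k, ∑ f ∈ s, ‖u k f‖ ^ 2 ≤ K) :
    ∑ f ∈ s, ‖∑ k, u k f‖ ^ 2 ≤ K * (Fintype.card κ : ℝ) ^ 2 := by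
  rw [sum_norm_sum_sq_eq]
  refine (Finset.sum_le_sum fun k _ => Finset.sum_le_sum fun l _ => (le_abs_self _).trans
    (abs_sum_re_inner_le s (u k) (u l) zero_le_one zero_le_one hK
      (by simpa using hu k) (by simpa using hu l))).trans (le_of_eq ?_)
  simp
  ring

end Hilbert

/-! ### Operator inequalities under *-homomorphisms, and orthogonal projections. -/

section Order

variable {E E' : Type*} [NormedAddCommGroup E] [InnerProductSpace ℂ E] [CompleteSpace E]
  [NormedAddCommGroup E'] [InnerProductSpace ℂ E'] [CompleteSpace E'] {F : Type*}

/-- As an operator inequality, the norm bound can be transported by any *-homomorphism, since these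
preserve order. -/
theorem sum_star_mul_self_le_iff (s : Finset F) (T : F → E →L[ℂ] E) (K : ℝ) :
    ∑ f ∈ s, star (T f) * T f ≤ (K : ℂ) • (1 : E →L[ℂ] E) ↔
      ∀ v, ∑ f ∈ s, ‖T f v‖ ^ 2 ≤ K * ‖v‖ ^ 2 := by
  have key : ∀ v, inner ℂ (((K : ℂ) • (1 : E →L[ℂ] E) - ∑ f ∈ s, star (T f) * T f) v) v =
      ((K * ‖v‖ ^ 2 - ∑ f ∈ s, ‖T f v‖ ^ 2 : ℝ) : ℂ) := by
    intro v
    have h1 : ∀ f, inner ℂ ((star (T f) * T f) v) v = ((‖T f v‖ ^ 2 : ℝ) : ℂ) := by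
      intro f
      rw [ContinuousLinearMap.star_eq_adjoint, mul_apply_eq_comp,
        ContinuousLinearMap.adjoint_inner_left, inner_self_eq_norm_sq_to_K]
      simp
    rw [_root_.sub_apply, inner_sub_left, _root_.sum_apply, sum_inner]
    simp only [h1]
    rw [_root_.smul_apply, one_apply_eq_self, inner_smul_left,
      inner_self_eq_norm_sq_to_K]
    simp
  rw [ContinuousLinearMap.le_def, ContinuousLinearMap.isPositive_iff_complex]
  simp only [key, RCLike.re_to_complex, Complex.ofReal_re, true_and, sub_nonneg]

theorem StarAlgHom.sum_norm_sq_le (Φ : (E →L[ℂ] E) →⋆ₐ[ℂ] (E' →L[ℂ] E')) (s : Finset F)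
    (T : F → E →L[ℂ] E) {K : ℝ} (h : ∀ v, ∑ f ∈ s, ‖T f v‖ ^ 2 ≤ K * ‖v‖ ^ 2) (v : E') :
    ∑ f ∈ s, ‖Φ (T f) v‖ ^ 2 ≤ K * ‖v‖ ^ 2 := by
  refine (sum_star_mul_self_le_iff s (fun f => Φ (T f)) K).1 ?_ v
  have h1 := OrderHomClass.mono Φ ((sum_star_mul_self_le_iff s T K).2 h)
  rwa [map_smul, map_one, map_sum, Finset.sum_congr rfl fun f _ => by
    rw [map_mul, map_star]] at h1

theorem inner_star_mul_self_eq {P : E →L[ℂ] E} (h1 : star P = P) (h2 : P * P = P) (v : E) :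
    inner ℂ v (P v) = ((‖P v‖ ^ 2 : ℝ) : ℂ) := by
  conv_lhs => rw [← h2, mul_apply_eq_comp, ← h1, ContinuousLinearMap.star_eq_adjoint,
    ContinuousLinearMap.adjoint_inner_right]
  rw [← ContinuousLinearMap.star_eq_adjoint, h1, inner_self_eq_norm_sq_to_K]
  simp

theorem norm_sub_apply_sq {P : E →L[ℂ] E} (h1 : star P = P) (h2 : P * P = P) (v : E) :
    ‖v - P v‖ ^ 2 = ‖v‖ ^ 2 - ‖P v‖ ^ 2 := by
  rw [@norm_sub_sq ℂ, inner_star_mul_self_eq h1 h2, RCLike.re_to_complex, Complex.ofReal_re]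
  ring

end Order

/-! ### Operators acting on a single tensor factor. -/

section Site

variable {N : ℕ} {d : Fin N → ℕ}

theorem agreeOff_iff {k : Fin N} {x y : TargetIdx d} :
    (∀ j, j ≠ k → x j = y j) ↔ y = Function.update x k (y k) := by
  rw [Function.eq_update_iff]
  exact ⟨fun h => ⟨rfl, fun j hj => (h j hj).symm⟩, fun h j hj => (h.2 j hj).symm⟩

theorem sum_agreeOff {M : Type*} [AddCommMonoid M] (k : Fin N) (x : TargetIdx d)
    (h : TargetIdx d → M) :
    ∑ y, (if ∀ j, j ≠ k → x j = y j then h y else 0) = ∑ a, h (Function.update x k a) := by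
  rw [← Finset.sum_filter]
  refine Finset.sum_bij' (fun y _ => y k) (fun a _ => Function.update x k a) ?_ ?_ ?_ ?_ ?_
  · simp
  · intro a _
    simp only [Finset.mem_filter, Finset.mem_univ, true_and]
    intro j hj
    rw [Function.update_of_ne hj]
  · intro y hy
    exact (agreeOff_iff.1 (Finset.mem_filter.1 hy).2).symm
  · simp
  · intro y hy
    rw [← agreeOff_iff.1 (Finset.mem_filter.1 hy).2]

/-- Entries of the operator on the target acting as `A` on the `k`-th factor. -/
def siteEntry (k : Fin N) (A : Matrix (Fin (d k)) (Fin (d k)) ℂ) :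
    Matrix (TargetIdx d) (TargetIdx d) ℂ :=
  fun x y => if ∀ j, j ≠ k → x j = y j then A (x k) (y k) else 0

theorem sum_siteEntry_mul (k : Fin N) (A : Matrix (Fin (d k)) (Fin (d k)) ℂ) (x : TargetIdx d)
    (g : TargetIdx d → ℂ) :
    ∑ y, siteEntry k A x y * g y = ∑ a, A (x k) a * g (Function.update x k a) := by
  simp only [siteEntry, ite_mul, zero_mul]
  rw [sum_agreeOff k x (fun y => A (x k) (y k) * g y)]
  simp

theorem siteEntry_mul (k : Fin N) (A B : Matrix (Fin (d k)) (Fin (d k)) ℂ) :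
    siteEntry k (A * B) = siteEntry k A * siteEntry k B := by
  ext x z
  rw [Matrix.mul_apply, sum_siteEntry_mul]
  have : ∀ a, (∀ j, j ≠ k → Function.update x k a j = z j) ↔ ∀ j, j ≠ k → x j = z j := fun a =>
    forall₂_congr fun j hj => by rw [Function.update_of_ne hj]
  simp only [siteEntry, this, Matrix.mul_apply, Function.update_self]
  split_ifs <;> simp

theorem siteEntry_one (k : Fin N) :
    siteEntry k (1 : Matrix (Fin (d k)) (Fin (d k)) ℂ) = 1 := by
  ext x y
  rw [siteEntry, Matrix.one_apply, Matrix.one_apply, ← ite_and]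
  congr 1
  refine propext ⟨fun h => funext fun j => ?_, fun h => by subst h; simp⟩
  by_cases hj : j = k
  · subst hj; exact h.2
  · exact h.1 j hj

/-- Operators on the `k`-th factor as operators on the target. -/
def siteMat (k : Fin N) :
    Matrix (Fin (d k)) (Fin (d k)) ℂ →⋆ₐ[ℂ] Matrix (TargetIdx d) (TargetIdx d) ℂ where
  toFun := siteEntry k
  map_one' := siteEntry_one k
  map_mul' := siteEntry_mul k
  map_zero' := by ext; simp [siteEntry]
  map_add' A B := by
    ext
    simp only [siteEntry, Matrix.add_apply]
    split_ifs <;> simp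
  commutes' c := by
    rw [Algebra.algebraMap_eq_smul_one, Algebra.algebraMap_eq_smul_one, ← siteEntry_one k]
    ext
    simp only [siteEntry, Matrix.smul_apply]
    split_ifs <;> simp
  map_star' A := by
    ext x y
    simp only [Matrix.star_apply, siteEntry, eq_comm (a := x _), apply_ite star, star_zero]

/-- The formula is symmetric under exchanging (k, A) and (l, B), which is what gives commutation. -/
theorem siteEntry_mul_siteEntry {k l : Fin N} (hkl : k ≠ l) (A : Matrix (Fin (d k)) (Fin (d k)) ℂ)
    (B : Matrix (Fin (d l)) (Fin (d l)) ℂ) (x z : TargetIdx d) :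
    (siteEntry k A * siteEntry l B) x z =
      if ∀ j, j ≠ k → j ≠ l → x j = z j then A (x k) (z k) * B (x l) (z l) else 0 := by
  rw [Matrix.mul_apply, sum_siteEntry_mul, Finset.sum_eq_single (z k)]
  · simp only [siteEntry]
    rw [Function.update_of_ne hkl.symm, mul_ite, mul_zero]
    congr 1
    refine propext ⟨fun h j h1 h2 => ?_, fun h j h2 => ?_⟩
    · rw [← h j h2, Function.update_of_ne h1]
    · by_cases h1 : j = k
      · subst h1; simp
      · rw [Function.update_of_ne h1, h j h1 h2]
  · intro a _ ha
    rw [siteEntry, if_neg, mul_zero]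
    exact fun h => ha (by simpa using h k hkl)
  · simp

theorem siteMat_commute {k l : Fin N} (hkl : k ≠ l) (A : Matrix (Fin (d k)) (Fin (d k)) ℂ)
    (B : Matrix (Fin (d l)) (Fin (d l)) ℂ) : Commute (siteMat k A) (siteMat l B) := by
  change siteEntry k A * siteEntry l B = siteEntry l B * siteEntry k A
  ext x z
  rw [siteEntry_mul_siteEntry hkl, siteEntry_mul_siteEntry hkl.symm, mul_comm]
  congr 1
  exact propext ⟨fun h j h1 h2 => h j h2 h1, fun h j h1 h2 => h j h2 h1⟩

/-- Operators on the `k`-th factor as bounded operators on the Hilbert space of the target. -/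
noncomputable def siteOp (k : Fin N) :
    Matrix (Fin (d k)) (Fin (d k)) ℂ →⋆ₐ[ℂ]
      (EuclideanSpace ℂ (TargetIdx d) →L[ℂ] EuclideanSpace ℂ (TargetIdx d)) :=
  (Matrix.toEuclideanCLM (𝕜 := ℂ) (n := TargetIdx d) : _ →⋆ₐ[ℂ] _).comp (siteMat k)

theorem siteOp_apply (k : Fin N) (A : Matrix (Fin (d k)) (Fin (d k)) ℂ) :
    siteOp k A = Matrix.toEuclideanCLM (𝕜 := ℂ) (siteMat k A) := rfl

theorem siteOp_commute {k l : Fin N} (hkl : k ≠ l) (A : Matrix (Fin (d k)) (Fin (d k)) ℂ)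
    (B : Matrix (Fin (d l)) (Fin (d l)) ℂ) : Commute (siteOp k A) (siteOp l B) :=
  (siteMat_commute hkl A B).map (Matrix.toEuclideanCLM (𝕜 := ℂ) (n := TargetIdx d))

/-- Tensoring with the identity is a *-homomorphism, so a bound on one factor survives with the same
constant, whatever the other dimensions. -/
theorem sum_norm_siteOp_sq_le {F : Type*} (k : Fin N) (s : Finset F)
    (A : F → Matrix (Fin (d k)) (Fin (d k)) ℂ) {K : ℝ}
    (h : ∀ v, ∑ f ∈ s, ‖Matrix.toEuclideanCLM (𝕜 := ℂ) (A f) v‖ ^ 2 ≤ K * ‖v‖ ^ 2)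
    (v : EuclideanSpace ℂ (TargetIdx d)) :
    ∑ f ∈ s, ‖siteOp k (A f) v‖ ^ 2 ≤ K * ‖v‖ ^ 2 := by
  have := StarAlgHom.sum_norm_sq_le ((siteOp k).comp
    ((Matrix.toEuclideanCLM (𝕜 := ℂ) (n := Fin (d k))).symm : _ →⋆ₐ[ℂ] _)) s
    (fun f => Matrix.toEuclideanCLM (𝕜 := ℂ) (A f)) h v
  simpa using this

end Site

/-! ### Rank-one projections, variances, and entropy against the largest eigenvalue. -/

section PureStates

variable {n : Type} [Fintype n]

theorem isUnitVec_iff {ψ : n → ℂ} : IsUnitVec ψ ↔ ‖WithLp.toLp 2 ψ‖ = 1 := by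
  rw [IsUnitVec, ← pow_eq_one_iff_of_nonneg (norm_nonneg _) two_ne_zero, EuclideanSpace.norm_sq_eq]

theorem star_dotProduct_mulVec_eq_inner [DecidableEq n] (φ ψ : n → ℂ) (A : Matrix n n ℂ) :
    star φ ⬝ᵥ A *ᵥ ψ =
      inner ℂ (WithLp.toLp 2 φ) (Matrix.toEuclideanCLM (𝕜 := ℂ) A (WithLp.toLp 2 ψ)) := by
  rw [Matrix.toEuclideanCLM_toLp, EuclideanSpace.inner_eq_star_dotProduct, dotProduct_comm]

theorem ketBra_mulVec (φ ψ : n → ℂ) : ketBra φ *ᵥ ψ = (star φ ⬝ᵥ ψ) • φ := by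
  rw [ketBra, Matrix.vecMulVec_mulVec]
  simp

theorem toEuclideanCLM_ketBra [DecidableEq n] (φ ψ : n → ℂ) :
    Matrix.toEuclideanCLM (𝕜 := ℂ) (ketBra φ) (WithLp.toLp 2 ψ) =
      inner ℂ (WithLp.toLp 2 φ) (WithLp.toLp 2 ψ) • WithLp.toLp 2 φ := by
  rw [Matrix.toEuclideanCLM_toLp, ketBra_mulVec, EuclideanSpace.inner_eq_star_dotProduct,
    dotProduct_comm]
  rfl

theorem star_dotProduct_self_of_isUnitVec {φ : n → ℂ} (h : IsUnitVec φ) : star φ ⬝ᵥ φ = 1 := by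
  have := isUnitVec_iff.1 h
  rw [dotProduct_comm, ← EuclideanSpace.inner_eq_star_dotProduct (WithLp.toLp 2 φ)
    (WithLp.toLp 2 φ), inner_self_eq_norm_sq_to_K, this]
  simp

theorem star_ketBra {n : Type} (φ : n → ℂ) : star (ketBra φ) = ketBra φ := ketBra_isHermitian φ

theorem ketBra_mul_mul_ketBra (A : Matrix n n ℂ) (φ : n → ℂ) :
    ketBra φ * A * ketBra φ = (star φ ⬝ᵥ A *ᵥ φ) • ketBra φ := by
  rw [Matrix.mul_assoc, ketBra, Matrix.mul_vecMulVec, Matrix.vecMulVec_mul_vecMulVec,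
    Matrix.vecMulVec_smul]

theorem ketBra_mul_self {φ : n → ℂ} (h : IsUnitVec φ) : ketBra φ * ketBra φ = ketBra φ := by
  classical
  have := ketBra_mul_mul_ketBra 1 φ
  rwa [Matrix.mul_one, Matrix.one_mulVec, star_dotProduct_self_of_isUnitVec h, one_smul] at this

theorem orthWeight_eq [DecidableEq n] (A : Matrix n n ℂ) (ψ : n → ℂ) :
    orthWeight A ψ = ‖Matrix.toEuclideanCLM (𝕜 := ℂ) A (WithLp.toLp 2 ψ)‖ ^ 2 -
      ‖inner ℂ (WithLp.toLp 2 ψ) (Matrix.toEuclideanCLM (𝕜 := ℂ) A (WithLp.toLp 2 ψ))‖ ^ 2 := by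
  rw [orthWeight, star_dotProduct_mulVec_eq_inner, ← Matrix.star_eq_conjTranspose, map_mul, map_mul,
    map_star, map_sub, map_one, mul_apply_eq_comp, mul_apply_eq_comp,
    ContinuousLinearMap.star_eq_adjoint, ContinuousLinearMap.adjoint_inner_right,
    _root_.sub_apply, one_apply_eq_self]
  conv_lhs => rw [Matrix.toEuclideanCLM_toLp, toEuclideanCLM_ketBra, ← Matrix.toEuclideanCLM_toLp]
  rw [inner_sub_right, inner_smul_right, inner_self_eq_norm_sq_to_K, Complex.sub_re,
    ← RCLike.re_to_complex (x := _ * _), inner_mul_symm_re_eq_norm, norm_mul,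
    norm_inner_symm (𝕜 := ℂ) (Matrix.toEuclideanCLM (𝕜 := ℂ) A (WithLp.toLp 2 ψ)), ← sq]
  norm_cast

/-- Take p i maximal: -p_j log p_j ≥ p_j (1 - p_j) ≥ p_j (1 - p_i), and sum over j. -/
theorem exists_one_sub_le_sum_negMulLog {ι : Type*} [Fintype ι] (p : ι → ℝ) (h0 : ∀ i, 0 ≤ p i)
    (h1 : ∑ i, p i = 1) : ∃ i, 1 - p i ≤ ∑ j, Real.negMulLog (p j) := by
  have hne : (Finset.univ : Finset ι).Nonempty := by
    by_contra h
    rw [Finset.not_nonempty_iff_eq_empty.1 h] at h1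
    simp at h1
  obtain ⟨i, -, hi⟩ := Finset.exists_max_image Finset.univ p hne
  refine ⟨i, ?_⟩
  calc 1 - p i = ∑ j, p j * (1 - p i) := by rw [← Finset.sum_mul, h1, one_mul]
    _ ≤ ∑ j, Real.negMulLog (p j) := Finset.sum_le_sum fun j _ => by
      rcases (h0 j).eq_or_lt with h | h
      · simp [← h]
      · rw [Real.negMulLog]
        have := Real.log_le_sub_one_of_pos h
        have := hi j (Finset.mem_univ j)
        nlinarith

end PureStates

/-! ### Reduced states and closeness to a product state. -/

section Reduced

variable {N : ℕ} {d : Fin N → ℕ}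

theorem trace_reduced (ρ : Matrix (TargetIdx d) (TargetIdx d) ℂ) (k : Fin N) :
    (reduced ρ k).trace = ρ.trace := by
  simp only [Matrix.trace, Matrix.diag_apply, reduced]
  rw [Finset.sum_comm]
  simp

theorem trace_ketBra {n : Type} [Fintype n] {ψ : n → ℂ} (h : IsUnitVec ψ) :
    (ketBra ψ).trace = 1 := by
  rw [ketBra, Matrix.trace_vecMulVec, dotProduct_comm, star_dotProduct_self_of_isUnitVec h]

/-- The conjugate on the left makes the two sums agree term by term, without reindexing. -/
theorem star_dotProduct_reduced_mulVec (ψ : TargetIdx d → ℂ) (k : Fin N) (φ : Fin (d k) → ℂ) :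
    star (star φ ⬝ᵥ reduced (ketBra ψ) k *ᵥ φ) = star ψ ⬝ᵥ siteMat k (ketBra φ) *ᵥ ψ := by
  have hr : ∀ x, (siteMat k (ketBra φ) *ᵥ ψ) x =
      ∑ a, ketBra φ (x k) a * ψ (Function.update x k a) :=
    fun x => sum_siteEntry_mul k (ketBra φ) x ψ
  simp only [dotProduct, hr]
  simp only [Matrix.mulVec, dotProduct, reduced, Finset.sum_mul, Finset.mul_sum, star_sum,
    ite_mul, zero_mul, mul_ite, mul_zero, apply_ite star, star_zero]
  have e : ∀ a : Fin (d k), ∑ b, ∑ x : TargetIdx d, (if x k = a then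
      star (star φ a * (ketBra ψ x (Function.update x k b) * φ b)) else 0) =
      ∑ x : TargetIdx d, if x k = a then
        ∑ b, star (star φ a * (ketBra ψ x (Function.update x k b) * φ b)) else 0 := by
    intro a
    rw [Finset.sum_comm]
    refine Finset.sum_congr rfl fun x _ => ?_
    split_ifs <;> simp
  simp only [e]
  rw [Finset.sum_comm]
  refine Finset.sum_congr rfl fun x _ => ?_
  rw [Finset.sum_ite_eq Finset.univ (x k)]
  simp only [Finset.mem_univ, if_true]
  refine Finset.sum_congr rfl fun b _ => ?_
  simp [ketBra, Matrix.vecMulVec_apply]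
  ring

theorem star_siteOp_ketBra (k : Fin N) (φ : Fin (d k) → ℂ) :
    star (siteOp k (ketBra φ)) = siteOp k (ketBra φ) := by rw [← map_star, star_ketBra]

theorem siteOp_ketBra_mul_self (k : Fin N) {φ : Fin (d k) → ℂ} (hφ : IsUnitVec φ) :
    siteOp k (ketBra φ) * siteOp k (ketBra φ) = siteOp k (ketBra φ) := by
  rw [← map_mul, ketBra_mul_self hφ]

/-- A pure state of low entropy at the `k`-th factor is close to a product state there. -/
theorem exists_norm_sub_siteOp_sq_le {ψ : TargetIdx d → ℂ} (hψ : IsUnitVec ψ) (k : Fin N) :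
    ∃ φ : Fin (d k) → ℂ, IsUnitVec φ ∧
      ‖WithLp.toLp 2 ψ - siteOp k (ketBra φ) (WithLp.toLp 2 ψ)‖ ^ 2 ≤ siteEntropy ψ k := by
  have hH := reduced_isHermitian (ketBra_isHermitian ψ) k
  have hunit : ∀ i, IsUnitVec (hH.eigenvectorBasis i).ofLp := fun i =>
    isUnitVec_iff.2 (hH.eigenvectorBasis.orthonormal.1 i)
  -- Each eigenvalue of the reduced state is the weight of ψ under the projection onto its
  -- eigenvector; for the largest one the missing weight 1 - λ is at most the entropy.
  have hev : ∀ i, hH.eigenvalues i =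
      ‖siteOp k (ketBra (hH.eigenvectorBasis i).ofLp) (WithLp.toLp 2 ψ)‖ ^ 2 := by
    intro i
    rw [hH.eigenvalues_eq, RCLike.re_to_complex, ← Complex.conj_re, ← Complex.star_def,
      star_dotProduct_reduced_mulVec, star_dotProduct_mulVec_eq_inner, ← siteOp_apply,
      inner_star_mul_self_eq (star_siteOp_ketBra k _) (siteOp_ketBra_mul_self k (hunit i)),
      Complex.ofReal_re]
  have hsum : ∑ i, hH.eigenvalues i = 1 := by
    have := hH.trace_eq_sum_eigenvalues
    rw [trace_reduced, trace_ketBra hψ] at this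
    exact Complex.ofReal_injective (by
      rw [Complex.ofReal_sum, Complex.ofReal_one]; exact this.symm)
  obtain ⟨i, hi⟩ := exists_one_sub_le_sum_negMulLog hH.eigenvalues
    (fun i => by rw [hev]; positivity) hsum
  refine ⟨_, hunit i, ?_⟩
  rw [norm_sub_apply_sq (star_siteOp_ketBra k _) (siteOp_ketBra_mul_self k (hunit i)),
    isUnitVec_iff.1 hψ, ← hev]
  rw [siteEntropy, vnEntropy, one_pow]
  exact hi

end Reduced

theorem siteEntropy_nonneg {N : ℕ} {d : Fin N → ℕ} {ψ : TargetIdx d → ℂ} (hψ : IsUnitVec ψ)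
    (k : Fin N) : 0 ≤ siteEntropy ψ k := by
  obtain ⟨φ, -, h⟩ := exists_norm_sub_siteOp_sq_le hψ k
  exact (sq_nonneg _).trans h

theorem sum_sqrt_le_card_mul_sqrt_avg {N : ℕ} (s : Fin N → ℝ) (hs : ∀ k, 0 ≤ s k) :
    ∑ k, √(s k) ≤ N * √((∑ k, s k) / N) := by
  rcases N.eq_zero_or_pos with rfl | hN
  · simp
  have hN' : (0 : ℝ) < N := by exact_mod_cast hN
  have h := sq_sum_le_card_mul_sum_sq (s := Finset.univ) (f := fun k => √(s k))
  simp only [Real.sq_sqrt (hs _), Finset.card_univ, Fintype.card_fin] at h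
  refine (Real.le_sqrt_of_sq_le h).trans (le_of_eq ?_)
  rw [show (N : ℝ) * ∑ k, s k = (N : ℝ) ^ 2 * ((∑ k, s k) / N) by field_simp,
    Real.sqrt_mul (by positivity), Real.sqrt_sq hN'.le]

/-! ### Collective scattering amplitudes of the whole target. -/

namespace ScatteringProcess

variable {N m : ℕ} {d : Fin N → ℕ} (P : ScatteringProcess N m d)

/-- `∑ₖ Tₖ^{i → f}` as an operator on the target. -/
noncomputable def targetT (f : Fin m) :
    EuclideanSpace ℂ (TargetIdx d) →L[ℂ] EuclideanSpace ℂ (TargetIdx d) :=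
  ∑ k, siteOp k (P.singleT k f)

theorem targetT_apply (f : Fin m) (v : EuclideanSpace ℂ (TargetIdx d)) :
    P.targetT f v = ∑ k, siteOp k (P.singleT k f) v := by
  rw [targetT, _root_.sum_apply]

variable {P}

theorem SinglePerpBound.mono {B B₁ : ℝ} (h : P.SinglePerpBound B) (hB : B ≤ B₁) :
    P.SinglePerpBound B₁ := fun k φ hφ => (h k φ hφ).trans hB

theorem SingleScatterBound.mono {B B₁ : ℝ} (h : P.SingleScatterBound B) (hB : B ≤ B₁) :
    P.SingleScatterBound B₁ := fun k φ hφ => (h k φ hφ).trans hB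

theorem SinglePerpBound.sum_norm_sub_mean_sq_le {B : ℝ} (hB : P.SinglePerpBound B) (k : Fin N)
    {φ : Fin (d k) → ℂ} (hφ : IsUnitVec φ) (v : EuclideanSpace ℂ (Fin (d k))) :
    ∑ f, ‖Matrix.toEuclideanCLM (𝕜 := ℂ)
      (P.singleT k f - (star φ ⬝ᵥ P.singleT k f *ᵥ φ) • 1) v‖ ^ 2 ≤ 40 * B * ‖v‖ ^ 2 := by
  have h := _root_.sum_norm_sub_mean_sq_le
    (fun f => (Matrix.toEuclideanCLM (𝕜 := ℂ) (P.singleT k f)).toLinearMap)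
    (B := B) (fun χ hχ => ?_) (isUnitVec_iff.1 hφ) v
  · refine le_trans (le_of_eq (Finset.sum_congr rfl fun f _ => ?_)) h
    rw [map_sub, map_smul, map_one, star_dotProduct_mulVec_eq_inner]
    rfl
  · have := hB k χ.ofLp (isUnitVec_iff.2 hχ)
    simp only [orthWeight_eq] at this
    exact this

/-- The scalar h f is the mean-field amplitude ∑ₖ ⟨φ_k|T_k^{i→f}|φ_k⟩. Both bounds are stated for
the same h because the second-order estimate uses them together. -/
theorem SinglePerpBound.exists_sum_norm_sub_smul_sq_le {B : ℝ} (hB0 : 0 ≤ B)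
    (hB : P.SinglePerpBound B) {ψ : TargetIdx d → ℂ} (hψ : IsUnitVec ψ) :
    ∃ h : Fin m → ℂ,
      ∑ f, ‖P.targetT f (WithLp.toLp 2 ψ) - h f • WithLp.toLp 2 ψ‖ ^ 2 ≤
        40 * B * (N + 2 * N ^ 2 * √((∑ k, siteEntropy ψ k) / N)) ∧
      ∑ f, ‖P.targetT f (WithLp.toLp 2 ψ) - h f • WithLp.toLp 2 ψ‖ ^ 2 ≤ 40 * B * (N : ℝ) ^ 2 := by
  choose φ hφ hs using exists_norm_sub_siteOp_sq_le hψ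
  set c : Fin N → Fin m → ℂ := fun k f => star (φ k) ⬝ᵥ P.singleT k f *ᵥ φ k with hc
  set A : ∀ (k : Fin N) (_ : Fin m), Matrix (Fin (d k)) (Fin (d k)) ℂ := fun k f =>
    P.singleT k f - c k f • 1 with hA
  set Ψ := WithLp.toLp 2 ψ with hΨ
  have hΨ1 : ‖Ψ‖ = 1 := isUnitVec_iff.1 hψ
  have hbound : ∀ k (v : EuclideanSpace ℂ (TargetIdx d)),
      ∑ f, ‖siteOp k (A k f) v‖ ^ 2 ≤ 40 * B * ‖v‖ ^ 2 := fun k v =>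
    sum_norm_siteOp_sq_le k Finset.univ (A k) (hB.sum_norm_sub_mean_sq_le k (hφ k)) v
  have hX : ∀ f, P.targetT f Ψ - (∑ k, c k f) • Ψ = ∑ k, siteOp k (A k f) Ψ := by
    intro f
    rw [targetT_apply, Finset.sum_smul, ← Finset.sum_sub_distrib]
    refine Finset.sum_congr rfl fun k _ => ?_
    rw [hA, map_sub, map_smul, map_one]
    rfl
  have hK : 0 ≤ 40 * B := by positivity
  refine ⟨fun f => ∑ k, c k f, ?_, ?_⟩
  · simp only [hX]
    have h1 := sum_norm_sum_sq_le (fun k f => siteOp k (A k f))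
      (fun k => siteOp k (ketBra (φ k))) hK hbound (fun k u v => ?_) (fun k v => ?_)
      (fun k f v => ?_) (fun k l hkl f v => ?_) hΨ1
    · refine h1.trans ?_
      have h2 : ∑ k, ‖Ψ - siteOp k (ketBra (φ k)) Ψ‖ ≤ N * √((∑ k, siteEntropy ψ k) / N) :=
        (Finset.sum_le_sum fun k _ => Real.le_sqrt_of_sq_le (hs k)).trans
          (sum_sqrt_le_card_mul_sqrt_avg _ (siteEntropy_nonneg hψ))
      rw [Fintype.card_fin]
      refine mul_le_mul_of_nonneg_left ?_ hK
      have h3 := mul_le_mul_of_nonneg_left h2 (by positivity : (0 : ℝ) ≤ 2 * N)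
      linarith
    · conv_lhs => rw [← star_siteOp_ketBra, ContinuousLinearMap.star_eq_adjoint,
        ContinuousLinearMap.adjoint_inner_left]
    · have h2 := norm_sub_apply_sq (star_siteOp_ketBra k (φ k)) (siteOp_ketBra_mul_self k (hφ k)) v
      have h3 := sq_nonneg ‖v - siteOp k (ketBra (φ k)) v‖
      exact le_of_sq_le_sq (by linarith) (norm_nonneg _)
    · rw [← mul_apply_eq_comp, ← mul_apply_eq_comp, ← map_mul, ← map_mul,
        ketBra_mul_mul_ketBra]
      have : star (φ k) ⬝ᵥ A k f *ᵥ φ k = 0 := by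
        rw [hA, Matrix.sub_mulVec, Matrix.smul_mulVec, Matrix.one_mulVec, dotProduct_sub,
          dotProduct_smul, star_dotProduct_self_of_isUnitVec (hφ k), smul_eq_mul, mul_one, sub_self]
      rw [this, zero_smul, map_zero, _root_.zero_apply]
    · exact DFunLike.congr_fun (siteOp_commute hkl.symm (ketBra (φ k)) (A l f)) v
  · simp only [hX]
    have h1 := sum_norm_sum_sq_le_card_sq Finset.univ (fun k f => siteOp k (A k f) Ψ) hK
      (fun k => by simpa [hΨ1] using hbound k Ψ)
    rwa [Fintype.card_fin] at h1

theorem SingleScatterBound.sum_norm_targetT_sq_le {B : ℝ} (hB0 : 0 ≤ B)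
    (hB : P.SingleScatterBound B) {ψ : TargetIdx d → ℂ} (hψ : IsUnitVec ψ) :
    ∑ f ∈ Finset.univ.erase P.i, ‖P.targetT f (WithLp.toLp 2 ψ)‖ ^ 2 ≤ B * (N : ℝ) ^ 2 := by
  simp only [targetT_apply]
  have h1 := sum_norm_sum_sq_le_card_sq (Finset.univ.erase P.i)
    (fun k f => siteOp k (P.singleT k f) (WithLp.toLp 2 ψ)) hB0 (fun k => ?_)
  · rwa [Fintype.card_fin] at h1
  have h2 := sum_norm_siteOp_sq_le k (Finset.univ.erase P.i) (P.singleT k) (K := B) ?_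
    (WithLp.toLp 2 ψ)
  · rwa [isUnitVec_iff.1 hψ, one_pow, mul_one] at h2
  intro v
  by_cases hv : v = 0
  · simp [hv]
  have hv0 : ‖v‖ ≠ 0 := norm_ne_zero_iff.2 hv
  have h3 := hB k (((‖v‖⁻¹ : ℝ) : ℂ) • v).ofLp (isUnitVec_iff.2 (by
    change ‖((‖v‖⁻¹ : ℝ) : ℂ) • v‖ = 1
    rw [norm_smul, Complex.norm_real, Real.norm_eq_abs, abs_inv, abs_norm, inv_mul_cancel₀ hv0]))
  have h4 : ∀ f, ∑ a, ‖(P.singleT k f *ᵥ (((‖v‖⁻¹ : ℝ) : ℂ) • v).ofLp) a‖ ^ 2 =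
      (‖v‖ ^ 2)⁻¹ * ‖Matrix.toEuclideanCLM (𝕜 := ℂ) (P.singleT k f) v‖ ^ 2 := by
    intro f
    rw [EuclideanSpace.norm_sq_eq (Matrix.toEuclideanCLM (𝕜 := ℂ) (P.singleT k f) v),
      Finset.mul_sum]
    refine Finset.sum_congr rfl fun a _ => ?_
    rw [WithLp.ofLp_smul, Matrix.mulVec_smul, Pi.smul_apply, norm_smul, mul_pow,
      Complex.norm_real, Real.norm_eq_abs, abs_inv, abs_norm, inv_pow]
    rfl
  simp only [h4, ← Finset.mul_sum] at h3
  rwa [inv_mul_le_iff₀ (by positivity), mul_comm] at h3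

end ScatteringProcess

/-! ### Expansions in the coupling as α → 0⁺. -/

section Asymptotic

theorem eq_zero_of_isLittleO_pow {c : ℝ} {n : ℕ}
    (h : (fun α : ℝ => c * α ^ n) =o[𝓝[>] (0 : ℝ)] fun α => α ^ n) : c = 0 := by
  have h1 := h.tendsto_div_nhds_zero
  have h2 : Tendsto (fun _ : ℝ => c) (𝓝[>] (0 : ℝ)) (𝓝 0) := by
    refine h1.congr' ?_
    filter_upwards [self_mem_nhdsWithin] with α hα
    rw [mul_div_assoc, div_self (pow_ne_zero _ (ne_of_gt hα)), mul_one]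
  exact tendsto_nhds_unique tendsto_const_nhds h2

theorem isLittleO_pow_succ (n : ℕ) :
    (fun α : ℝ => α ^ (n + 1)) =o[𝓝[>] (0 : ℝ)] fun α => α ^ n :=
  (isLittleO_pow_pow (Nat.lt_succ_self n)).mono nhdsWithin_le_nhds

/-- `Detectable` brings its own coefficient, known only up to o(αⁿ); this identifies it with the
computed one. -/
theorem leading_coeff_unique {s : ℝ → ℝ} {a b : ℝ} {n : ℕ}
    (ha : (fun α => s α - a * α ^ n) =O[𝓝[>] (0 : ℝ)] fun α => α ^ (n + 1))
    (hb : (fun α => s α - b * α ^ n) =o[𝓝[>] (0 : ℝ)] fun α => α ^ n) : a = b := by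
  have h := hb.sub (ha.trans_isLittleO (isLittleO_pow_succ n))
  have := eq_zero_of_isLittleO_pow (c := a - b) (n := n) (h.congr_left fun α => by ring)
  linarith

theorem isBigO_pow_of_sub_mul_pow {s : ℝ → ℝ} {a : ℝ} {n : ℕ}
    (h : (fun α => s α - a * α ^ n) =O[𝓝[>] (0 : ℝ)] fun α => α ^ (n + 1)) :
    s =O[𝓝[>] (0 : ℝ)] fun α => α ^ n :=
  ((h.trans (isLittleO_pow_succ n).isBigO).add
    ((isBigO_refl (fun α : ℝ => α ^ n) (𝓝[>] (0 : ℝ))).const_mul_left a)).congr_left fun α => by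
      ring

variable {E : Type*} [NormedAddCommGroup E] [InnerProductSpace ℂ E]

theorem re_inner_self_eq_norm_sq (v : E) : (inner ℂ v v).re = ‖v‖ ^ 2 :=
  inner_self_eq_norm_sq (𝕜 := ℂ) v

theorem isBigO_re_inner (M : E →L[ℂ] E) {l : Filter ℝ} {u v : ℝ → E} {f g : ℝ → ℝ}
    (hu : u =O[l] f) (hv : v =O[l] g) :
    (fun α => (inner ℂ (u α) (M (v α))).re) =O[l] fun α => f α * g α := by
  refine IsBigO.trans (IsBigO.of_norm_le fun α => ?_)
    (hu.norm_left.mul ((M.isBigO_comp v l).trans hv).norm_left)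
  exact (Complex.abs_re_le_norm _).trans (norm_inner_le_norm _ _)

theorem re_inner_expansion_one (M : E →L[ℂ] E) {u : ℝ → E} {u₀ w : E}
    (hu : (fun α : ℝ => u α - u₀ - (α : ℂ) • w) =O[𝓝[>] (0 : ℝ)] fun α => α ^ 2) :
    (fun α : ℝ => (inner ℂ (u α) (M (u α))).re - (inner ℂ u₀ (M u₀)).re
      - ((inner ℂ u₀ (M w)).re + (inner ℂ w (M u₀)).re) * α) =O[𝓝[>] (0 : ℝ)]
      fun α => α ^ 2 := by
  have hid : (fun α : ℝ => α ^ 2) =O[𝓝[>] (0 : ℝ)] fun α : ℝ => α := by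
    simpa using (isLittleO_pow_succ 1).isBigO
  have hw : (fun α : ℝ => (α : ℂ) • w) =O[𝓝[>] (0 : ℝ)] fun α => α := by
    refine IsBigO.of_bound ‖w‖ (Eventually.of_forall fun α => ?_)
    rw [norm_smul, Complex.norm_real, mul_comm]
  have hd : (fun α : ℝ => u α - u₀) =O[𝓝[>] (0 : ℝ)] fun α => α :=
    ((hu.trans hid).add hw).congr_left fun α => by abel
  have h0 : (fun _ : ℝ => u₀) =O[𝓝[>] (0 : ℝ)] fun _ => (1 : ℝ) := isBigO_const_const _ one_ne_zero _
  -- With r the O(α²) remainder of u and δ = u - u₀ = O(α), the error is exactly ⟨u₀, M r⟩ + ⟨r, M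
  -- u₀⟩ + ⟨δ, M δ⟩.
  have t1 := isBigO_re_inner M h0 hu
  have t2 := isBigO_re_inner M hu h0
  have t3 := isBigO_re_inner M hd hd
  simp only [one_mul, mul_one, ← sq] at t1 t2 t3
  refine ((t1.add t2).add t3).congr_left fun α => ?_
  simp only [map_sub, map_smul, inner_sub_left, inner_sub_right, inner_smul_left, inner_smul_right,
    Complex.conj_ofReal, Complex.sub_re, Complex.re_ofReal_mul]
  ring

/-- Because u has no constant term, its expansion to first order already determines the quadratic
form up to O(α³). -/
theorem re_inner_expansion_two (M : E →L[ℂ] E) {u : ℝ → E} {w : E}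
    (hu : (fun α : ℝ => u α - (α : ℂ) • w) =O[𝓝[>] (0 : ℝ)] fun α => α ^ 2) :
    (fun α : ℝ => (inner ℂ (u α) (M (u α))).re - (inner ℂ w (M w)).re * α ^ 2)
      =O[𝓝[>] (0 : ℝ)] fun α => α ^ 3 := by
  have hid : (fun α : ℝ => α ^ 2) =O[𝓝[>] (0 : ℝ)] fun α : ℝ => α := by
    simpa using (isLittleO_pow_succ 1).isBigO
  have hw : (fun α : ℝ => (α : ℂ) • w) =O[𝓝[>] (0 : ℝ)] fun α => α := by
    refine IsBigO.of_bound ‖w‖ (Eventually.of_forall fun α => ?_)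
    rw [norm_smul, Complex.norm_real, mul_comm]
  have hd : u =O[𝓝[>] (0 : ℝ)] fun α => α :=
    ((hu.trans hid).add hw).congr_left fun α => by abel
  have t1 := isBigO_re_inner M hw hu
  have t2 := isBigO_re_inner M hu hd
  refine ((t1.congr_right fun α => ?_).add (t2.congr_right fun α => ?_)).congr_left fun α => ?_
  · ring
  · ring
  · simp only [map_sub, map_smul, inner_sub_left, inner_sub_right, inner_smul_left,
      inner_smul_right, Complex.conj_ofReal, Complex.sub_re, Complex.re_ofReal_mul]
    ring

end Asymptotic

/-! ### Tests as contractions, and traces as inner products. -/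

section Tests

variable {n : Type} [Fintype n] [DecidableEq n]

theorem Matrix.PosSemidef.toEuclideanCLM_isPositive {M : Matrix n n ℂ} (h : M.PosSemidef) :
    (Matrix.toEuclideanCLM (𝕜 := ℂ) M).IsPositive :=
  (ContinuousLinearMap.isPositive_iff _).2
    ((LinearMap.isPositive_iff _).1 (Matrix.isPositive_toEuclideanLin_iff.2 h))

theorem IsTest.norm_apply_le {M : Matrix n n ℂ} (hM : IsTest M) (v : EuclideanSpace ℂ n) :
    ‖Matrix.toEuclideanCLM (𝕜 := ℂ) M v‖ ≤ ‖v‖ := by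
  have h0 : 0 ≤ Matrix.toEuclideanCLM (𝕜 := ℂ) M :=
    (ContinuousLinearMap.nonneg_iff_isPositive _).2 hM.1.toEuclideanCLM_isPositive
  have h1 : Matrix.toEuclideanCLM (𝕜 := ℂ) M ≤ 1 := by
    rw [ContinuousLinearMap.le_def, ← map_one (Matrix.toEuclideanCLM (𝕜 := ℂ)), ← map_sub]
    exact hM.2.toEuclideanCLM_isPositive
  have h2 := (CStarAlgebra.norm_le_one_iff_of_nonneg _ h0).2 h1
  exact ((Matrix.toEuclideanCLM (𝕜 := ℂ) M).le_of_opNorm_le h2 v).trans_eq (one_mul _)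

theorem IsTest.abs_re_inner_le {M : Matrix n n ℂ} (hM : IsTest M) (u v : EuclideanSpace ℂ n) :
    |(inner ℂ u (Matrix.toEuclideanCLM (𝕜 := ℂ) M v)).re| ≤ ‖u‖ * ‖v‖ :=
  (Complex.abs_re_le_norm _).trans ((norm_inner_le_norm _ _).trans
    (mul_le_mul_of_nonneg_left (hM.norm_apply_le v) (norm_nonneg _)))

theorem IsTest.inner_self_eq_re {M : Matrix n n ℂ} (hM : IsTest M) (v : EuclideanSpace ℂ n) :
    inner ℂ v (Matrix.toEuclideanCLM (𝕜 := ℂ) M v) =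
      ((inner ℂ v (Matrix.toEuclideanCLM (𝕜 := ℂ) M v)).re : ℂ) := by
  have h := ((ContinuousLinearMap.isPositive_iff_complex _).1 hM.1.toEuclideanCLM_isPositive v).1
  rw [← inner_conj_symm, ← h]
  simp

theorem trace_mul_conj_ketBra (M K : Matrix n n ℂ) (ψ : n → ℂ) :
    (M * (K * ketBra ψ * Kᴴ)).trace =
      inner ℂ (Matrix.toEuclideanCLM (𝕜 := ℂ) K (WithLp.toLp 2 ψ))
        (Matrix.toEuclideanCLM (𝕜 := ℂ) M
          (Matrix.toEuclideanCLM (𝕜 := ℂ) K (WithLp.toLp 2 ψ))) := by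
  rw [Matrix.toEuclideanCLM_toLp, ← star_dotProduct_mulVec_eq_inner, ketBra, Matrix.mul_vecMulVec,
    Matrix.vecMulVec_mul, ← Matrix.star_mulVec, Matrix.mul_vecMulVec, Matrix.trace_vecMulVec,
    dotProduct_comm]

theorem isBigO_toEuclideanCLM_apply {R : ℝ → Matrix n n ℂ} {l : Filter ℝ} {g : ℝ → ℝ}
    (h : ∀ x y, (fun α => R α x y) =O[l] g) (ψ : n → ℂ) :
    (fun α => Matrix.toEuclideanCLM (𝕜 := ℂ) (R α) (WithLp.toLp 2 ψ)) =O[l] g := by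
  simp only [Matrix.toEuclideanCLM_toLp]
  have hL := ((EuclideanSpace.equiv n ℂ).symm : (n → ℂ) →L[ℂ] EuclideanSpace ℂ n).isBigO_comp
    (fun α => R α *ᵥ ψ) l
  have hR : (fun α => R α *ᵥ ψ) =O[l] g := by
    refine (isBigO_pi (E' := fun _ : n => ℂ)).2 fun x => ?_
    simp only [Matrix.mulVec, dotProduct]
    refine IsBigO.fun_sum fun y _ => ?_
    exact ((h x y).const_mul_left (ψ y)).congr_left fun α => mul_comm _ _
  exact hL.trans hR

end Tests

/-! ### Outgoing target vectors and the signal in a pure state. -/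

namespace ScatteringProcess

variable {N m : ℕ} {d : Fin N → ℕ} (P : ScatteringProcess N m d)

/-- The (unnormalised) target state after scattering into the particle state `f`. -/
noncomputable def outVec (α : ℝ) (f : Fin m) (ψ : TargetIdx d → ℂ) :
    EuclideanSpace ℂ (TargetIdx d) :=
  Matrix.toEuclideanCLM (𝕜 := ℂ) (P.kraus α f) (WithLp.toLp 2 ψ)

/-- First-order coefficient of `outVec`. -/
noncomputable def outVec₁ (f : Fin m) (ψ : TargetIdx d → ℂ) : EuclideanSpace ℂ (TargetIdx d) :=
  Complex.I • P.targetT f (WithLp.toLp 2 ψ)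

theorem outVec_expansion (f : Fin m) (ψ : TargetIdx d → ℂ) :
    (fun α : ℝ => P.outVec α f ψ - (if f = P.i then WithLp.toLp 2 ψ else 0)
      - (α : ℂ) • P.outVec₁ f ψ) =O[𝓝[>] (0 : ℝ)] fun α => α ^ 2 := by
  have h := isBigO_toEuclideanCLM_apply (R := fun α => P.kraus α f - (if f = P.i then 1 else 0)
    - (Complex.I * (α : ℂ)) • ∑ k, siteMat k (P.singleT k f)) (l := 𝓝[>] (0 : ℝ))
    (g := fun α => α ^ 2) (fun x y => ?_) ψ
  · refine h.congr_left fun α => ?_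
    rw [map_sub, map_sub, map_smul, map_sum, _root_.sub_apply, _root_.sub_apply,
      _root_.smul_apply, _root_.sum_apply, outVec, outVec₁, targetT_apply, smul_smul,
      mul_comm (α : ℂ)]
    congr 2
    split_ifs <;> simp
  · refine (P.expansion (f, x) (P.i, y)).congr_left fun α => ?_
    simp only [Matrix.sub_apply, Matrix.smul_apply, Matrix.sum_apply]
    congr 2
    by_cases hf : f = P.i
    · rw [if_pos hf, hf, Matrix.one_apply, Matrix.one_apply]
      simp
    · rw [if_neg hf, Matrix.one_apply_ne (by simp [hf])]
      rfl

theorem sum_norm_outVec_sq {α : ℝ}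
    (h : P.S α ∈ Matrix.unitaryGroup (Fin m × TargetIdx d) ℂ) {ψ : TargetIdx d → ℂ}
    (hψ : IsUnitVec ψ) : ∑ f, ‖P.outVec α f ψ‖ ^ 2 = 1 := by
  have h1 : ∑ f, star (P.kraus α f) * P.kraus α f = 1 := by
    ext x y
    have h2 := congrFun (congrFun (Matrix.mem_unitaryGroup_iff'.1 h) (P.i, x)) (P.i, y)
    rw [Matrix.mul_apply, Fintype.sum_prod_type] at h2
    rw [Matrix.sum_apply]
    simp only [Matrix.mul_apply]
    refine h2.trans ?_
    rw [Matrix.one_apply, Matrix.one_apply]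
    simp
  have h3 : ∀ f, ((‖P.outVec α f ψ‖ ^ 2 : ℝ) : ℂ) = inner ℂ (WithLp.toLp 2 ψ)
      (Matrix.toEuclideanCLM (𝕜 := ℂ) (star (P.kraus α f) * P.kraus α f) (WithLp.toLp 2 ψ)) := by
    intro f
    rw [map_mul, map_star, mul_apply_eq_comp, ContinuousLinearMap.star_eq_adjoint,
      ContinuousLinearMap.adjoint_inner_right, inner_self_eq_norm_sq_to_K]
    simp [outVec]
  apply Complex.ofReal_injective
  rw [Complex.ofReal_sum]
  simp only [h3]
  rw [← inner_sum, ← _root_.sum_apply, ← map_sum, h1, map_one, one_apply_eq_self,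
    inner_self_eq_norm_sq_to_K, isUnitVec_iff.1 hψ]
  simp

/-- The signal of the test `M` in the pure state `ψ`. -/
noncomputable def pureSignal (ψ : TargetIdx d → ℂ) (M : Matrix (TargetIdx d) (TargetIdx d) ℂ)
    (α : ℝ) : ℝ :=
  ∑ f, (inner ℂ (P.outVec α f ψ) (Matrix.toEuclideanCLM (𝕜 := ℂ) M (P.outVec α f ψ))).re -
    (inner ℂ (WithLp.toLp 2 ψ) (Matrix.toEuclideanCLM (𝕜 := ℂ) M (WithLp.toLp 2 ψ))).re

theorem signal_eq_sum {ρ : Matrix (TargetIdx d) (TargetIdx d) ℂ} (D : PureDecomposition ρ)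
    (M : Matrix (TargetIdx d) (TargetIdx d) ℂ) (α : ℝ) :
    P.signal ρ M α = ∑ l, D.p l * P.pureSignal (D.ψ l) M α := by
  have h1 : (M * P.finalState ρ α).trace = ∑ l, (D.p l : ℂ) * ∑ f,
      inner ℂ (P.outVec α f (D.ψ l))
        (Matrix.toEuclideanCLM (𝕜 := ℂ) M (P.outVec α f (D.ψ l))) := by
    simp only [outVec, ← trace_mul_conj_ketBra]
    rw [finalState]
    conv_lhs => rw [D.eq_sum]
    simp only [Finset.mul_sum, Finset.sum_mul, Matrix.trace_sum, Matrix.mul_smul, Matrix.smul_mul,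
      Matrix.trace_smul, smul_eq_mul]
    exact Finset.sum_comm
  have h2 : (M * ρ).trace = ∑ l, (D.p l : ℂ) * inner ℂ (WithLp.toLp 2 (D.ψ l))
      (Matrix.toEuclideanCLM (𝕜 := ℂ) M (WithLp.toLp 2 (D.ψ l))) := by
    have h3 := fun l => trace_mul_conj_ketBra M 1 (D.ψ l)
    simp only [map_one, one_apply_eq_self, Matrix.one_mul, Matrix.conjTranspose_one,
      Matrix.mul_one] at h3
    simp only [← h3]
    conv_lhs => rw [D.eq_sum]
    simp only [Finset.mul_sum, Matrix.trace_sum, Matrix.mul_smul, Matrix.trace_smul, smul_eq_mul]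
  rw [signal, h1, h2]
  simp only [Complex.re_sum, Complex.re_ofReal_mul, pureSignal, mul_sub, Finset.sum_sub_distrib]

end ScatteringProcess

/-! ### Leading coefficients of the signal in a pure state. -/

namespace ScatteringProcess

variable {N m : ℕ} {d : Fin N → ℕ} (P : ScatteringProcess N m d)

/-- Coefficient of `α` in the signal of `M` in the pure state `ψ`. -/
noncomputable def coeffOne (ψ : TargetIdx d → ℂ) (M : Matrix (TargetIdx d) (TargetIdx d) ℂ) : ℝ :=
  (inner ℂ (WithLp.toLp 2 ψ) (Matrix.toEuclideanCLM (𝕜 := ℂ) M (P.outVec₁ P.i ψ))).re +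
    (inner ℂ (P.outVec₁ P.i ψ) (Matrix.toEuclideanCLM (𝕜 := ℂ) M (WithLp.toLp 2 ψ))).re

/-- Coefficient of `α ^ 2` in the signal of `M` in the pure state `ψ`, if the forward amplitude
leaves `ψ` invariant. -/
noncomputable def coeffTwo (ψ : TargetIdx d → ℂ) (M : Matrix (TargetIdx d) (TargetIdx d) ℂ) : ℝ :=
  ∑ f ∈ Finset.univ.erase P.i,
    ((inner ℂ (P.outVec₁ f ψ) (Matrix.toEuclideanCLM (𝕜 := ℂ) M (P.outVec₁ f ψ))).re -
      ‖P.outVec₁ f ψ‖ ^ 2 *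
        (inner ℂ (WithLp.toLp 2 ψ) (Matrix.toEuclideanCLM (𝕜 := ℂ) M (WithLp.toLp 2 ψ))).re)

theorem outVec_expansion_of_ne {f : Fin m} (hf : f ≠ P.i) (ψ : TargetIdx d → ℂ) :
    (fun α : ℝ => P.outVec α f ψ - (α : ℂ) • P.outVec₁ f ψ)
      =O[𝓝[>] (0 : ℝ)] fun α => α ^ 2 := by
  simpa [hf] using P.outVec_expansion f ψ

theorem pureSignal_expansion_one (ψ : TargetIdx d → ℂ)
    (M : Matrix (TargetIdx d) (TargetIdx d) ℂ) :
    (fun α : ℝ => P.pureSignal ψ M α - P.coeffOne ψ M * α) =O[𝓝[>] (0 : ℝ)] fun α => α ^ 2 := by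
  have h1 := re_inner_expansion_one (Matrix.toEuclideanCLM (𝕜 := ℂ) M)
    (u₀ := WithLp.toLp 2 ψ) (by simpa using P.outVec_expansion P.i ψ)
  have h2 : (fun α : ℝ => ∑ f ∈ Finset.univ.erase P.i, (inner ℂ (P.outVec α f ψ)
      (Matrix.toEuclideanCLM (𝕜 := ℂ) M (P.outVec α f ψ))).re)
      =O[𝓝[>] (0 : ℝ)] fun α => α ^ 2 := by
    refine IsBigO.fun_sum fun f hf => ?_
    have h3 := re_inner_expansion_two (Matrix.toEuclideanCLM (𝕜 := ℂ) M)
      (P.outVec_expansion_of_ne (Finset.ne_of_mem_erase hf) ψ)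
    exact isBigO_pow_of_sub_mul_pow h3
  refine (h1.add h2).congr_left fun α => ?_
  rw [pureSignal, coeffOne, ← Finset.add_sum_erase _ _ (Finset.mem_univ P.i)]
  ring

/-- By unitarity the test M = 1 has no signal at small coupling; its first-order coefficient is
twice this real part. -/
theorem re_inner_outVec₁_eq_zero {ψ : TargetIdx d → ℂ} (hψ : IsUnitVec ψ) :
    (inner ℂ (WithLp.toLp 2 ψ) (P.outVec₁ P.i ψ)).re = 0 := by
  have h1 := P.pureSignal_expansion_one ψ 1
  have h2 : (fun α : ℝ => P.pureSignal ψ 1 α - 0 * α ^ 1)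
      =o[𝓝[>] (0 : ℝ)] fun α => α ^ 1 := by
    refine (isLittleO_zero _ _).congr' ?_ EventuallyEq.rfl
    filter_upwards [P.unitary] with α hα
    have h3 := P.sum_norm_outVec_sq hα hψ
    simp only [pureSignal, map_one, one_apply_eq_self, re_inner_self_eq_norm_sq,
      isUnitVec_iff.1 hψ, h3]
    norm_num
  have h4 : P.coeffOne ψ 1 = 0 := leading_coeff_unique (n := 1) (by simpa using h1) h2
  rw [coeffOne, map_one, one_apply_eq_self, one_apply_eq_self, ← inner_conj_symm (P.outVec₁ P.i ψ),
    Complex.conj_re] at h4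
  linarith

/-- In w = iX + ihΨ the second term contributes 2 Re(ih) ⟨Ψ|M|Ψ⟩, and `re_inner_outVec₁_eq_zero`
gives Re(ih) = -Re⟨Ψ, iX⟩. Every term thus carries a factor X, with constants 1 + 1 + 2. -/
theorem abs_coeffOne_le {ψ : TargetIdx d → ℂ} (hψ : IsUnitVec ψ)
    {M : Matrix (TargetIdx d) (TargetIdx d) ℂ} (hM : IsTest M) (h : ℂ) :
    |P.coeffOne ψ M| ≤ 4 * ‖P.targetT P.i (WithLp.toLp 2 ψ) - h • WithLp.toLp 2 ψ‖ := by
  set Ψ := WithLp.toLp 2 ψ with hΨ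
  have hΨ1 : ‖Ψ‖ = 1 := isUnitVec_iff.1 hψ
  set X := P.targetT P.i Ψ - h • Ψ with hX
  set T := Matrix.toEuclideanCLM (𝕜 := ℂ) M with hT
  have hw : P.outVec₁ P.i ψ = Complex.I • X + (Complex.I * h) • Ψ := by
    rw [outVec₁, hX, smul_sub, smul_smul, sub_add_cancel]
  have hXn : ‖Complex.I • X‖ = ‖X‖ := by rw [norm_smul, Complex.norm_I, one_mul]
  have h0 := P.re_inner_outVec₁_eq_zero hψ
  rw [hw, inner_add_right, inner_smul_right Ψ Ψ, inner_self_eq_norm_sq_to_K, hΨ1,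
    RCLike.ofReal_one, one_pow, mul_one, Complex.add_re] at h0
  have b0 : |(inner ℂ Ψ (Complex.I • X)).re| ≤ ‖X‖ :=
    (Complex.abs_re_le_norm _).trans ((norm_inner_le_norm _ _).trans_eq (by
      rw [hΨ1, one_mul, hXn]))
  have b1 := hM.abs_re_inner_le Ψ (Complex.I • X)
  have b2 := hM.abs_re_inner_le (Complex.I • X) Ψ
  have b3 := hM.abs_re_inner_le Ψ Ψ
  rw [hΨ1, hXn, one_mul] at b1
  rw [hΨ1, hXn, mul_one] at b2
  rw [hΨ1, one_mul] at b3
  have e : P.coeffOne ψ M = (inner ℂ Ψ (T (Complex.I • X))).re +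
      (inner ℂ (Complex.I • X) (T Ψ)).re - 2 * ((inner ℂ Ψ (Complex.I • X)).re *
        (inner ℂ Ψ (T Ψ)).re) := by
    rw [coeffOne, hw, map_add, map_smul T (Complex.I * h), inner_add_left, inner_add_right,
      inner_smul_left Ψ, inner_smul_right Ψ (T Ψ), hM.inner_self_eq_re Ψ, Complex.add_re,
      Complex.add_re, Complex.re_mul_ofReal, Complex.re_mul_ofReal, Complex.conj_re,
      Complex.ofReal_re, eq_neg_of_add_eq_zero_right h0]
    ring
  have b4 : |(inner ℂ Ψ (Complex.I • X)).re * (inner ℂ Ψ (T Ψ)).re| ≤ ‖X‖ * 1 := by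
    rw [abs_mul]
    exact mul_le_mul b0 b3 (abs_nonneg _) (norm_nonneg _)
  rw [e]
  rw [abs_le] at *
  constructor <;> linarith [b1.1, b1.2, b2.1, b2.2, b4.1, b4.2]

theorem outVec_eq_smul_of_pPerp_eq_zero {ψ : TargetIdx d → ℂ} (hψ : IsUnitVec ψ) {α : ℝ}
    {f : Fin m} (h : P.pPerp α f ψ = 0) :
    P.outVec α f ψ = inner ℂ (WithLp.toLp 2 ψ) (P.outVec α f ψ) • WithLp.toLp 2 ψ := by
  rw [pPerp, orthWeight_eq, ← norm_sub_inner_smul_sq (isUnitVec_iff.1 hψ)] at h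
  exact sub_eq_zero.1 (norm_eq_zero.1 (pow_eq_zero_iff two_ne_zero |>.1 h))

/-- The forward output is cψ with |c|² = 1 - ∑_{f≠i} ‖out_f‖². Eliminating |c|² is exact, so the
unknown α² term of the forward amplitude never enters. -/
theorem pureSignal_eq_of_pPerp_eq_zero {ψ : TargetIdx d → ℂ} (hψ : IsUnitVec ψ) {α : ℝ}
    (hα : P.S α ∈ Matrix.unitaryGroup (Fin m × TargetIdx d) ℂ) (h : P.pPerp α P.i ψ = 0)
    (M : Matrix (TargetIdx d) (TargetIdx d) ℂ) :
    P.pureSignal ψ M α = ∑ f ∈ Finset.univ.erase P.i,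
      ((inner ℂ (P.outVec α f ψ) (Matrix.toEuclideanCLM (𝕜 := ℂ) M (P.outVec α f ψ))).re -
      ‖P.outVec α f ψ‖ ^ 2 *
        (inner ℂ (WithLp.toLp 2 ψ)
          (Matrix.toEuclideanCLM (𝕜 := ℂ) M (WithLp.toLp 2 ψ))).re) := by
  have h1 := P.sum_norm_outVec_sq hα hψ
  rw [← Finset.add_sum_erase _ _ (Finset.mem_univ P.i)] at h1
  have h2 := P.outVec_eq_smul_of_pPerp_eq_zero hψ h
  set c := inner ℂ (WithLp.toLp 2 ψ) (P.outVec α P.i ψ) with hc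
  have h3 : ‖P.outVec α P.i ψ‖ ^ 2 = ‖c‖ ^ 2 := by
    rw [h2, norm_smul, isUnitVec_iff.1 hψ, mul_one]
  have h4 : (inner ℂ (P.outVec α P.i ψ)
      (Matrix.toEuclideanCLM (𝕜 := ℂ) M (P.outVec α P.i ψ))).re = ‖c‖ ^ 2 *
      (inner ℂ (WithLp.toLp 2 ψ) (Matrix.toEuclideanCLM (𝕜 := ℂ) M (WithLp.toLp 2 ψ))).re := by
    rw [h2, map_smul, inner_smul_left, inner_smul_right, ← mul_assoc, Complex.conj_mul',
      ← Complex.ofReal_pow, Complex.re_ofReal_mul]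
  rw [pureSignal, ← Finset.add_sum_erase _ _ (Finset.mem_univ P.i), h4,
    Finset.sum_sub_distrib, ← Finset.sum_mul]
  rw [h3] at h1
  linear_combination (inner ℂ (WithLp.toLp 2 ψ)
    (Matrix.toEuclideanCLM (𝕜 := ℂ) M (WithLp.toLp 2 ψ))).re * h1

theorem pureSignal_expansion_two {ψ : TargetIdx d → ℂ} (hψ : IsUnitVec ψ)
    (h : ∀ᶠ α in 𝓝[>] (0 : ℝ), P.pPerp α P.i ψ = 0)
    (M : Matrix (TargetIdx d) (TargetIdx d) ℂ) :
    (fun α : ℝ => P.pureSignal ψ M α - P.coeffTwo ψ M * α ^ 2)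
      =O[𝓝[>] (0 : ℝ)] fun α => α ^ 3 := by
  set μ := (inner ℂ (WithLp.toLp 2 ψ)
    (Matrix.toEuclideanCLM (𝕜 := ℂ) M (WithLp.toLp 2 ψ))).re with hμ
  have h1 : (fun α : ℝ => ∑ f ∈ Finset.univ.erase P.i,
      (((inner ℂ (P.outVec α f ψ) (Matrix.toEuclideanCLM (𝕜 := ℂ) M (P.outVec α f ψ))).re -
      ‖P.outVec α f ψ‖ ^ 2 * μ) -
      ((inner ℂ (P.outVec₁ f ψ) (Matrix.toEuclideanCLM (𝕜 := ℂ) M (P.outVec₁ f ψ))).re -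
      ‖P.outVec₁ f ψ‖ ^ 2 * μ) * α ^ 2)) =O[𝓝[>] (0 : ℝ)] fun α => α ^ 3 := by
    refine IsBigO.fun_sum fun f hf => ?_
    have hu := P.outVec_expansion_of_ne (Finset.ne_of_mem_erase hf) ψ
    have t1 := re_inner_expansion_two (Matrix.toEuclideanCLM (𝕜 := ℂ) M) hu
    -- The identity in place of M expands the squared norms.
    have t2 := re_inner_expansion_two (1 : EuclideanSpace ℂ (TargetIdx d) →L[ℂ] _) hu
    simp only [one_apply_eq_self, re_inner_self_eq_norm_sq] at t2
    refine (t1.sub (t2.const_mul_left μ)).congr_left fun α => ?_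
    ring
  refine h1.congr' ?_ EventuallyEq.rfl
  filter_upwards [P.unitary, h] with α hα hp
  rw [P.pureSignal_eq_of_pPerp_eq_zero hψ hα hp M, coeffTwo, Finset.sum_sub_distrib,
    ← Finset.sum_mul]

/-- In w = Y + gΨ the term |g|² ⟨Ψ|M|Ψ⟩ cancels between the two parts of `coeffTwo`, and what
remains is at most 2‖Y‖² + 4‖Y‖|g|. With |g| ≤ ‖w‖ + ‖Y‖ this is 6‖Y‖² + 4‖Y‖‖w‖; Cauchy–Schwarz
then sums over f. -/
theorem coeffTwo_le {ψ : TargetIdx d → ℂ} (hψ : IsUnitVec ψ)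
    {M : Matrix (TargetIdx d) (TargetIdx d) ℂ} (hM : IsTest M) (h : Fin m → ℂ) {x y : ℝ}
    (hx : 0 ≤ x) (hy : 0 ≤ y)
    (hX : ∑ f, ‖P.targetT f (WithLp.toLp 2 ψ) - h f • WithLp.toLp 2 ψ‖ ^ 2 ≤ x ^ 2)
    (hY : ∑ f ∈ Finset.univ.erase P.i, ‖P.targetT f (WithLp.toLp 2 ψ)‖ ^ 2 ≤ y ^ 2) :
    P.coeffTwo ψ M ≤ 6 * x ^ 2 + 4 * (y * x) := by
  set Ψ := WithLp.toLp 2 ψ with hΨ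
  have hΨ1 : ‖Ψ‖ = 1 := isUnitVec_iff.1 hψ
  set T := Matrix.toEuclideanCLM (𝕜 := ℂ) M with hT
  have key : ∀ f, ((inner ℂ (P.outVec₁ f ψ) (T (P.outVec₁ f ψ))).re -
      ‖P.outVec₁ f ψ‖ ^ 2 * (inner ℂ Ψ (T Ψ)).re) ≤
      6 * ‖P.targetT f Ψ - h f • Ψ‖ ^ 2 +
        4 * (‖P.targetT f Ψ‖ * ‖P.targetT f Ψ - h f • Ψ‖) := by
    intro f
    set w := P.outVec₁ f ψ with hw
    set X := P.targetT f Ψ - h f • Ψ with hX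
    set Y := Complex.I • X with hY
    set g := Complex.I * h f with hg
    have hwY : w = Y + g • Ψ := by
      rw [hw, outVec₁, hY, hX, smul_sub, smul_smul, sub_add_cancel]
    have hYn : ‖Y‖ = ‖X‖ := by rw [hY, norm_smul, Complex.norm_I, one_mul]
    have hwn : ‖w‖ = ‖P.targetT f Ψ‖ := by rw [hw, outVec₁, norm_smul, Complex.norm_I, one_mul]
    have hgn : ‖g‖ ≤ ‖w‖ + ‖Y‖ := by
      have : ‖g • Ψ‖ ≤ ‖w‖ + ‖Y‖ := by
        rw [show g • Ψ = w - Y by rw [hwY]; abel]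
        exact norm_sub_le _ _
      rwa [norm_smul, hΨ1, mul_one] at this
    have hgΨ : ‖g • Ψ‖ = ‖g‖ := by rw [norm_smul, hΨ1, mul_one]
    have b1 := hM.abs_re_inner_le Y Y
    have b2 := hM.abs_re_inner_le Y (g • Ψ)
    have b3 := hM.abs_re_inner_le (g • Ψ) Y
    have b4 := hM.abs_re_inner_le Ψ Ψ
    have b5 : |(inner ℂ Y (g • Ψ)).re| ≤ ‖Y‖ * ‖g • Ψ‖ :=
      (Complex.abs_re_le_norm _).trans (norm_inner_le_norm _ _)
    rw [hgΨ] at b2 b3 b5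
    rw [hΨ1, one_mul] at b4
    have e1 : (inner ℂ w (T w)).re = (inner ℂ Y (T Y)).re + (inner ℂ Y (T (g • Ψ))).re +
        (inner ℂ (g • Ψ) (T Y)).re + ‖g‖ ^ 2 * (inner ℂ Ψ (T Ψ)).re := by
      have : (inner ℂ (g • Ψ) (T (g • Ψ))).re = ‖g‖ ^ 2 * (inner ℂ Ψ (T Ψ)).re := by
        rw [map_smul, inner_smul_left, inner_smul_right, ← mul_assoc, Complex.conj_mul',
          ← Complex.ofReal_pow, Complex.re_ofReal_mul]
      rw [← this, hwY, map_add, inner_add_left, inner_add_right, inner_add_right]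
      simp only [Complex.add_re]
      ring
    have e2 : ‖w‖ ^ 2 = ‖Y‖ ^ 2 + 2 * (inner ℂ Y (g • Ψ)).re + ‖g‖ ^ 2 := by
      rw [hwY, @norm_add_sq ℂ, hgΨ]
      rfl
    have b6 : |‖Y‖ ^ 2 * (inner ℂ Ψ (T Ψ)).re| ≤ ‖Y‖ ^ 2 * 1 := by
      rw [abs_mul, abs_of_nonneg (sq_nonneg ‖Y‖)]
      exact mul_le_mul_of_nonneg_left b4 (sq_nonneg _)
    have b7 : |(inner ℂ Y (g • Ψ)).re * (inner ℂ Ψ (T Ψ)).re| ≤ ‖Y‖ * ‖g‖ * 1 := by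
      rw [abs_mul]
      exact mul_le_mul b5 b4 (abs_nonneg _) (by positivity)
    have b8 : ‖Y‖ * ‖g‖ ≤ ‖Y‖ * (‖w‖ + ‖Y‖) := mul_le_mul_of_nonneg_left hgn (norm_nonneg _)
    rw [← hwn, ← hYn, e1]
    calc _ = (inner ℂ Y (T Y)).re + (inner ℂ Y (T (g • Ψ))).re + (inner ℂ (g • Ψ) (T Y)).re -
          ‖Y‖ ^ 2 * (inner ℂ Ψ (T Ψ)).re -
          2 * ((inner ℂ Y (g • Ψ)).re * (inner ℂ Ψ (T Ψ)).re) := by rw [e2]; ring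
      _ ≤ ‖Y‖ * ‖Y‖ + ‖Y‖ * ‖g‖ + ‖g‖ * ‖Y‖ + ‖Y‖ ^ 2 * 1 + 2 * (‖Y‖ * ‖g‖ * 1) := by
          linarith [le_of_abs_le b1, le_of_abs_le b2, le_of_abs_le b3, neg_le_of_abs_le b6,
            neg_le_of_abs_le b7]
      _ ≤ _ := by linarith
  have hX' : ∑ f ∈ Finset.univ.erase P.i, ‖P.targetT f Ψ - h f • Ψ‖ ^ 2 ≤ x ^ 2 :=
    (Finset.sum_le_sum_of_subset_of_nonneg (Finset.erase_subset _ _)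
      fun _ _ _ => sq_nonneg _).trans hX
  have hYX : ∑ f ∈ Finset.univ.erase P.i, ‖P.targetT f Ψ‖ * ‖P.targetT f Ψ - h f • Ψ‖ ≤ y * x :=
    (Real.sum_mul_le_sqrt_mul_sqrt _ _ _).trans
      (mul_le_mul (Real.sqrt_le_iff.2 ⟨hy, hY⟩)
        (Real.sqrt_le_iff.2 ⟨hx, hX'⟩) (Real.sqrt_nonneg _) hy)
  refine (Finset.sum_le_sum fun f _ => key f).trans ?_
  rw [Finset.sum_add_distrib, ← Finset.mul_sum, ← Finset.mul_sum]
  linarith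

end ScatteringProcess

theorem sum_mul_sqrt_le_sqrt {ι : Type*} [Fintype ι] (p s : ι → ℝ) (hp : ∀ l, 0 ≤ p l)
    (h1 : ∑ l, p l = 1) (hs : ∀ l, 0 ≤ s l) : ∑ l, p l * √(s l) ≤ √(∑ l, p l * s l) :=
  Real.strictConcaveOn_sqrt.concaveOn.le_map_sum (t := Finset.univ) (w := p) (p := s)
    (fun l _ => hp l) h1 fun l _ => hs l

theorem sq_sum_mul_le {ι : Type*} [Fintype ι] (p s : ι → ℝ) (hp : ∀ l, 0 ≤ p l)
    (h1 : ∑ l, p l = 1) : (∑ l, p l * s l) ^ 2 ≤ ∑ l, p l * s l ^ 2 :=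
  (even_two.convexOn_pow (𝕜 := ℝ)).map_sum_le (t := Finset.univ) (w := p) (p := s)
    (fun l _ => hp l) h1 fun _ _ => Set.mem_univ _

/-! ### Pure-state decompositions and the infimum over them. -/

section Decompositions

variable {N : ℕ} {d : Fin N → ℕ} {ρ : Matrix (TargetIdx d) (TargetIdx d) ℂ}

theorem PureDecomposition.avgSite_nonneg (D : PureDecomposition ρ) (l : Fin D.size) :
    0 ≤ (∑ k, siteEntropy (D.ψ l) k) / N :=
  div_nonneg (Finset.sum_nonneg fun k _ => siteEntropy_nonneg (D.unit l) k) (Nat.cast_nonneg N)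

theorem PureDecomposition.avgEntropy_nonneg (D : PureDecomposition ρ) : 0 ≤ D.avgEntropy :=
  Finset.sum_nonneg fun l _ => mul_nonneg (D.p_nonneg l) (D.avgSite_nonneg l)

theorem Matrix.IsHermitian.eq_sum_smul_ketBra {n : Type} [Fintype n] [DecidableEq n]
    {A : Matrix n n ℂ} (hA : A.IsHermitian) :
    A = ∑ i, (hA.eigenvalues i : ℂ) • ketBra (hA.eigenvectorBasis i).ofLp := by
  conv_lhs => rw [hA.spectral_theorem, Unitary.conjStarAlgAut_apply]
  ext x y
  rw [Matrix.mul_apply, Matrix.sum_apply]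
  refine Finset.sum_congr rfl fun i _ => ?_
  rw [Matrix.mul_diagonal, Matrix.smul_apply, ketBra, Matrix.vecMulVec_apply, Matrix.star_apply,
    Matrix.IsHermitian.eigenvectorUnitary_apply, Matrix.IsHermitian.eigenvectorUnitary_apply]
  simp
  ring

theorem IsDensity.nonempty_pureDecomposition (h : IsDensity ρ) :
    Nonempty (PureDecomposition ρ) := by
  have hH := h.1.1
  let e := Fintype.equivFin (TargetIdx d)
  refine ⟨⟨Fintype.card (TargetIdx d), fun l => hH.eigenvalues (e.symm l),
    fun l => (hH.eigenvectorBasis (e.symm l)).ofLp, fun l => h.1.eigenvalues_nonneg _, ?_,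
    fun l => isUnitVec_iff.2 (hH.eigenvectorBasis.orthonormal.1 _), ?_⟩⟩
  · rw [e.symm.sum_comp fun i => hH.eigenvalues i]
    have := hH.trace_eq_sum_eigenvalues
    rw [h.2] at this
    exact Complex.ofReal_injective (by
      rw [Complex.ofReal_sum, Complex.ofReal_one]; exact this.symm)
  · rw [e.symm.sum_comp fun i =>
      (hH.eigenvalues i : ℂ) • ketBra (hH.eigenvectorBasis i).ofLp]
    exact hH.eq_sum_smul_ketBra

/-- The infimum need not be attained, but it is a limit of values of `avgEntropy`, and {E | c ≤ g E}
is closed. Monotonicity of g is not needed. -/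
theorem le_apply_entanglementMF (hne : Nonempty (PureDecomposition ρ)) {g : ℝ → ℝ}
    (hg : Continuous g) {c : ℝ} (h : ∀ D : PureDecomposition ρ, c ≤ g D.avgEntropy) :
    c ≤ g (entanglementMF ρ) := by
  have hmem : entanglementMF ρ ∈ closure (Set.range (PureDecomposition.avgEntropy (ρ := ρ))) :=
    csInf_mem_closure (Set.range_nonempty _) ⟨0, by
      rintro _ ⟨D, rfl⟩
      exact D.avgEntropy_nonneg⟩
  refine closure_minimal ?_ (isClosed_le continuous_const hg) hmem
  rintro _ ⟨D, rfl⟩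
  exact h D

end Decompositions

/-! ### From signal coefficients to detection limits. -/

namespace ScatteringProcess

variable {N m : ℕ} {d : Fin N → ℕ} {P : ScatteringProcess N m d}
  {ρ : Matrix (TargetIdx d) (TargetIdx d) ℂ}

theorem one_div_alphaMin_sq_le {power ε : ℝ} {n : ℕ} {R : ℝ}
    (h : ∀ α, 0 < α → P.Detectable ρ power ε n α → 1 ≤ R * α ^ 2) :
    1 / P.alphaMin ρ power ε n ^ 2 ≤ ENNReal.ofReal R := by
  rw [one_div, ENNReal.inv_le_iff_inv_le]
  -- For R ≤ 0 no coupling is detectable, so the limit is ∞ and its inverse square 0.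
  rcases le_or_gt R 0 with hR | hR
  · have : P.alphaMin ρ power ε n = ⊤ := by
      refine iInf₂_eq_top.2 fun α hα => ?_
      have := h α hα.1 hα.2
      nlinarith [sq_nonneg α]
    rw [this]
    simp
  · have h1 : ENNReal.ofReal (√R)⁻¹ ≤ P.alphaMin ρ power ε n := by
      refine le_iInf₂ fun α hα => ENNReal.ofReal_le_ofReal ?_
      have h2 := h α hα.1 hα.2
      rw [inv_le_iff_one_le_mul₀ (Real.sqrt_pos.2 hR)]
      refine (sq_le_sq₀ zero_le_one (mul_nonneg hα.1.le (Real.sqrt_nonneg _))).1 ?_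
      rw [mul_pow, Real.sq_sqrt hR.le]
      linarith
    calc (ENNReal.ofReal R)⁻¹ = ENNReal.ofReal (√R)⁻¹ ^ 2 := by
          rw [← ENNReal.ofReal_pow (by positivity), inv_pow, Real.sq_sqrt hR.le,
            ENNReal.ofReal_inv_of_pos hR]
      _ ≤ _ := by gcongr

/-- The first-order coefficient of the signal is the average of `coeffOne`. -/
theorem signal_expansion_one (D : PureDecomposition ρ)
    (M : Matrix (TargetIdx d) (TargetIdx d) ℂ) :
    (fun α : ℝ => P.signal ρ M α - (∑ l, D.p l * P.coeffOne (D.ψ l) M) * α)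
      =O[𝓝[>] (0 : ℝ)] fun α => α ^ 2 := by
  have h : (fun α : ℝ => ∑ l, D.p l * (P.pureSignal (D.ψ l) M α - P.coeffOne (D.ψ l) M * α))
      =O[𝓝[>] (0 : ℝ)] fun α => α ^ 2 :=
    IsBigO.fun_sum fun l _ => (P.pureSignal_expansion_one (D.ψ l) M).const_mul_left _
  refine h.congr_left fun α => ?_
  rw [P.signal_eq_sum D, Finset.sum_mul, ← Finset.sum_sub_distrib]
  exact Finset.sum_congr rfl fun l _ => by ring

theorem signal_expansion_two {D : PureDecomposition ρ} (hD : P.NoForward D)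
    (M : Matrix (TargetIdx d) (TargetIdx d) ℂ) :
    (fun α : ℝ => P.signal ρ M α - (∑ l, D.p l * P.coeffTwo (D.ψ l) M) * α ^ 2)
      =O[𝓝[>] (0 : ℝ)] fun α => α ^ 3 := by
  have h : (fun α : ℝ => ∑ l, D.p l * (P.pureSignal (D.ψ l) M α - P.coeffTwo (D.ψ l) M * α ^ 2))
      =O[𝓝[>] (0 : ℝ)] fun α => α ^ 3 := by
    refine IsBigO.fun_sum fun l _ => ?_
    -- `NoForward` says nothing about components of weight 0; their terms vanish.
    rcases (D.p_nonneg l).eq_or_lt with h0 | h0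
    · simpa [← h0] using isBigO_zero _ _
    · exact (P.pureSignal_expansion_two (D.unit l) (hD l h0) M).const_mul_left _
  refine h.congr_left fun α => ?_
  rw [P.signal_eq_sum D, Finset.sum_mul, ← Finset.sum_sub_distrib]
  exact Finset.sum_congr rfl fun l _ => by ring

theorem effectIsSecondOrder {D : PureDecomposition ρ} (hD : P.NoForward D) :
    P.EffectIsSecondOrder ρ := fun M _ =>
  ⟨isBigO_pow_of_sub_mul_pow (signal_expansion_two hD M), _, signal_expansion_two hD M⟩

theorem sq_sum_coeffOne_le {B : ℝ} (hB0 : 0 ≤ B) (hB : P.SinglePerpBound B)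
    (D : PureDecomposition ρ) {M : Matrix (TargetIdx d) (TargetIdx d) ℂ} (hM : IsTest M) :
    (∑ l, D.p l * P.coeffOne (D.ψ l) M) ^ 2 ≤
      1280 * B * (N + (N : ℝ) ^ 2 * √D.avgEntropy) := by
  have h1 : ∀ l, P.coeffOne (D.ψ l) M ^ 2 ≤
      640 * B * (N + 2 * N ^ 2 * √((∑ k, siteEntropy (D.ψ l) k) / N)) := by
    intro l
    obtain ⟨h, hx, -⟩ := hB.exists_sum_norm_sub_smul_sq_le hB0 (D.unit l)
    have h2 := P.abs_coeffOne_le (D.unit l) hM (h P.i)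
    have h3 := (Finset.single_le_sum (f := fun f => ‖P.targetT f (WithLp.toLp 2 (D.ψ l)) -
      h f • WithLp.toLp 2 (D.ψ l)‖ ^ 2) (fun f _ => sq_nonneg _) (Finset.mem_univ P.i)).trans hx
    have h4 := pow_le_pow_left₀ (abs_nonneg _) h2 2
    rw [sq_abs, mul_pow] at h4
    linarith
  have h5 := sum_mul_sqrt_le_sqrt D.p _ D.p_nonneg D.p_sum D.avgSite_nonneg
  change _ ≤ √D.avgEntropy at h5
  have hN : 0 ≤ B * (N : ℝ) ^ 2 := by positivity
  have hN' : 0 ≤ B * (N : ℝ) := by positivity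
  -- Convexity of the square, then concavity of the root (`h5`). The constant 640 is 4² · 40,
  -- doubled by the cross terms.
  calc _ ≤ ∑ l, D.p l * P.coeffOne (D.ψ l) M ^ 2 := sq_sum_mul_le _ _ D.p_nonneg D.p_sum
    _ ≤ ∑ l, D.p l * (640 * B * (N + 2 * N ^ 2 * √((∑ k, siteEntropy (D.ψ l) k) / N))) :=
        Finset.sum_le_sum fun l _ => mul_le_mul_of_nonneg_left (h1 l) (D.p_nonneg l)
    _ = ∑ l, (640 * (B * N) * D.p l +
          1280 * (B * N ^ 2) * (D.p l * √((∑ k, siteEntropy (D.ψ l) k) / N))) :=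
        Finset.sum_congr rfl fun l _ => by ring
    _ = 640 * (B * N) + 1280 * (B * N ^ 2) *
          ∑ l, D.p l * √((∑ k, siteEntropy (D.ψ l) k) / N) := by
        rw [Finset.sum_add_distrib, ← Finset.mul_sum, ← Finset.mul_sum, D.p_sum, mul_one]
    _ ≤ 640 * (B * N) + 1280 * (B * N ^ 2) * √D.avgEntropy := by gcongr
    _ ≤ _ := by linarith

/-- In 6x² + 4yx = (6x + 4y)x the first factor gets the crude bounds, linear in N, and the second
the entanglement-sensitive one. This produces N·√N and N² times a fourth root. -/
theorem coeffTwo_le_of_bounds {B B' : ℝ} (hB0 : 0 ≤ B) (hB : P.SinglePerpBound B)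
    (hB0' : 0 ≤ B') (hB' : P.SingleScatterBound B') {ψ : TargetIdx d → ℂ} (hψ : IsUnitVec ψ)
    {M : Matrix (TargetIdx d) (TargetIdx d) ℂ} (hM : IsTest M) :
    P.coeffTwo ψ M ≤ (6 * √(40 * B) + 4 * √B') * √(40 * B) *
      (N * √N + 2 * N ^ 2 * √√((∑ k, siteEntropy ψ k) / N)) := by
  obtain ⟨h, hx1, hx2⟩ := hB.exists_sum_norm_sub_smul_sq_le hB0 hψ
  have hy := hB'.sum_norm_targetT_sq_le hB0' hψ
  set x2 := ∑ f, ‖P.targetT f (WithLp.toLp 2 ψ) - h f • WithLp.toLp 2 ψ‖ ^ 2 with hx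
  set S := (∑ k, siteEntropy ψ k) / N with hS
  have hx0 : 0 ≤ x2 := Finset.sum_nonneg fun f _ => sq_nonneg _
  have h1 := P.coeffTwo_le hψ hM h (x := √x2) (y := √B' * N) (Real.sqrt_nonneg _) (by positivity)
    (by rw [Real.sq_sqrt hx0]) (by rwa [mul_pow, Real.sq_sqrt hB0'])
  have h2 : √x2 ≤ √(40 * B) * N := by
    refine (Real.sqrt_le_sqrt hx2).trans_eq ?_
    rw [Real.sqrt_mul (by positivity), Real.sqrt_sq (Nat.cast_nonneg N)]
  have h3 : √x2 ≤ √(40 * B) * (√N + 2 * N * √√S) := by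
    refine (Real.sqrt_le_sqrt hx1).trans ?_
    rw [Real.sqrt_mul (by positivity)]
    refine mul_le_mul_of_nonneg_left (Real.sqrt_le_iff.2 ⟨by positivity, ?_⟩) (Real.sqrt_nonneg _)
    have e1 : √(N : ℝ) ^ 2 = N := Real.sq_sqrt (Nat.cast_nonneg N)
    have e2 : √√S ^ 2 = √S := Real.sq_sqrt (Real.sqrt_nonneg _)
    have e3 : (√N + 2 * N * √√S) ^ 2 = N + 4 * N ^ 2 * √S + 4 * (√N * N * √√S) := by
      rw [add_sq, mul_pow, e1, e2]; ring
    rw [e3]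
    have e4 : 0 ≤ √N * N * √√S := by positivity
    have e5 : 0 ≤ (N : ℝ) ^ 2 * √S := by positivity
    linarith
  calc P.coeffTwo ψ M ≤ (6 * √x2 + 4 * (√B' * N)) * √x2 := by linarith
    _ ≤ (6 * (√(40 * B) * N) + 4 * (√B' * N)) * (√(40 * B) * (√N + 2 * N * √√S)) := by gcongr
    _ = _ := by ring

theorem sum_coeffTwo_le {B B' : ℝ} (hB0 : 0 ≤ B) (hB : P.SinglePerpBound B)
    (hB0' : 0 ≤ B') (hB' : P.SingleScatterBound B') (D : PureDecomposition ρ)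
    {M : Matrix (TargetIdx d) (TargetIdx d) ℂ} (hM : IsTest M) :
    ∑ l, D.p l * P.coeffTwo (D.ψ l) M ≤ 2 * ((6 * √(40 * B) + 4 * √B') * √(40 * B)) *
      ((N : ℝ) ^ (3 / 2 : ℝ) + (N : ℝ) ^ 2 * D.avgEntropy ^ (1 / 4 : ℝ)) := by
  set K := (6 * √(40 * B) + 4 * √B') * √(40 * B) with hK
  have hK0 : 0 ≤ K := by positivity
  set S : Fin D.size → ℝ := fun l => (∑ k, siteEntropy (D.ψ l) k) / N with hS
  -- Jensen twice, once for each square root.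
  have h5 : ∑ l, D.p l * √√(S l) ≤ √√D.avgEntropy :=
    (sum_mul_sqrt_le_sqrt D.p (fun l => √(S l)) D.p_nonneg D.p_sum
      fun l => Real.sqrt_nonneg _).trans
      (Real.sqrt_le_sqrt (sum_mul_sqrt_le_sqrt D.p S D.p_nonneg D.p_sum D.avgSite_nonneg))
  have e1 : (N : ℝ) ^ (3 / 2 : ℝ) = N * √N := by
    rw [Real.sqrt_eq_rpow]
    rcases N.eq_zero_or_pos with h | h
    · rw [h, Nat.cast_zero, Real.zero_rpow (by norm_num), zero_mul]
    · rw [← Real.rpow_one_add' (Nat.cast_nonneg N) (by norm_num)]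
      norm_num
  have e2 : D.avgEntropy ^ (1 / 4 : ℝ) = √√D.avgEntropy := by
    rw [Real.sqrt_eq_rpow, Real.sqrt_eq_rpow, ← Real.rpow_mul D.avgEntropy_nonneg]
    norm_num
  rw [e1, e2]
  have hN : 0 ≤ K * ((N : ℝ) * √N) := by positivity
  calc _ ≤ ∑ l, D.p l * (K * (N * √N + 2 * N ^ 2 * √√(S l))) :=
        Finset.sum_le_sum fun l _ => mul_le_mul_of_nonneg_left
          (coeffTwo_le_of_bounds hB0 hB hB0' hB' (D.unit l) hM) (D.p_nonneg l)
    _ = ∑ l, (K * (N * √N) * D.p l + 2 * K * N ^ 2 * (D.p l * √√(S l))) :=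
        Finset.sum_congr rfl fun l _ => by ring
    _ = K * (N * √N) + 2 * K * N ^ 2 * ∑ l, D.p l * √√(S l) := by
        rw [Finset.sum_add_distrib, ← Finset.mul_sum, ← Finset.mul_sum, D.p_sum, mul_one]
    _ ≤ K * (N * √N) + 2 * K * N ^ 2 * √√D.avgEntropy := by gcongr
    _ ≤ _ := by linarith

theorem Detectable.one_le_of_one {power ε : ℝ} (hεpower : ε < power) {B : ℝ} (hB0 : 0 ≤ B)
    (hB : P.SinglePerpBound B) (D : PureDecomposition ρ) {α : ℝ} (hα : 0 < α)
    (h : P.Detectable ρ power ε 1 α) :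
    1 ≤ 1280 * B / (power - ε) ^ 2 * (N + (N : ℝ) ^ 2 * √D.avgEntropy) * α ^ 2 := by
  obtain ⟨M, a, hM, ha, hε, hp⟩ := h
  have hδ : 0 < power - ε := sub_pos.2 hεpower
  have h1 := leading_coeff_unique (n := 1) (by simpa using signal_expansion_one D M) ha
  have h2 := sq_sum_coeffOne_le hB0 hB D hM
  rw [h1] at h2
  have h3 : power - ε ≤ a * α := by rw [pow_one] at hp; linarith
  have h4 : (power - ε) ^ 2 ≤ a ^ 2 * α ^ 2 := by
    rw [← mul_pow]; exact pow_le_pow_left₀ hδ.le h3 2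
  have h5 : a ^ 2 * α ^ 2 ≤ 1280 * B * (N + (N : ℝ) ^ 2 * √D.avgEntropy) * α ^ 2 := by gcongr
  rw [div_mul_eq_mul_div, div_mul_eq_mul_div, one_le_div (by positivity)]
  exact h4.trans h5

theorem Detectable.one_le_of_two {power ε : ℝ} (hεpower : ε < power) {B B' : ℝ} (hB0 : 0 ≤ B)
    (hB : P.SinglePerpBound B) (hB0' : 0 ≤ B') (hB' : P.SingleScatterBound B')
    {D : PureDecomposition ρ} (hD : P.NoForward D) {α : ℝ} (h : P.Detectable ρ power ε 2 α) :
    1 ≤ 2 * ((6 * √(40 * B) + 4 * √B') * √(40 * B)) / (power - ε) *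
      ((N : ℝ) ^ (3 / 2 : ℝ) + (N : ℝ) ^ 2 * D.avgEntropy ^ (1 / 4 : ℝ)) * α ^ 2 := by
  obtain ⟨M, a, hM, ha, hε, hp⟩ := h
  have hδ : 0 < power - ε := sub_pos.2 hεpower
  have h1 := leading_coeff_unique (signal_expansion_two hD M) ha
  have h2 := sum_coeffTwo_le hB0 hB hB0' hB' D hM
  rw [h1] at h2
  have h3 := mul_le_mul_of_nonneg_right h2 (sq_nonneg α)
  rw [div_mul_eq_mul_div, div_mul_eq_mul_div, one_le_div hδ]
  linarith

end ScatteringProcess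

theorem mainTheorem5 (power ε : ℝ) (hεpower : ε < power) (B : ℝ) :
    (∃ C : ℝ, ∀ (N m : ℕ) (d : Fin N → ℕ) (P : ScatteringProcess N m d)
      (ρ : Matrix (TargetIdx d) (TargetIdx d) ℂ), IsDensity ρ → P.SinglePerpBound B →
        (∀ M, IsTest M → ∃ a : ℝ,
          (fun α : ℝ => P.signal ρ M α - a * α) =O[𝓝[>] (0 : ℝ)] fun α => α ^ 2) ∧
        1 / P.alphaMin ρ power ε 1 ^ 2 ≤
          ENNReal.ofReal (C * (N + (N : ℝ) ^ 2 * √(entanglementMF ρ)))) ∧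
    (∀ B' : ℝ, ∃ C : ℝ, ∀ (N m : ℕ) (d : Fin N → ℕ) (P : ScatteringProcess N m d)
      (ρ : Matrix (TargetIdx d) (TargetIdx d) ℂ), IsDensity ρ → P.SinglePerpBound B →
      P.SingleScatterBound B' →
        ((∀ D : PureDecomposition ρ, P.NoForward D) →
          P.EffectIsSecondOrder ρ ∧
          1 / P.alphaMin ρ power ε 2 ^ 2 ≤ ENNReal.ofReal
            (C * ((N : ℝ) ^ (3 / 2 : ℝ) + (N : ℝ) ^ 2 * entanglementMF ρ ^ (1 / 4 : ℝ)))) ∧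
        (∀ D : PureDecomposition ρ, P.NoForward D →
          P.EffectIsSecondOrder ρ ∧
          1 / P.alphaMin ρ power ε 2 ^ 2 ≤ ENNReal.ofReal
            (C * ((N : ℝ) ^ (3 / 2 : ℝ) + (N : ℝ) ^ 2 * D.avgEntropy ^ (1 / 4 : ℝ))))) := by
  -- B and B' may be negative, for instance when N = 0 makes their hypotheses vacuous; hence the
  -- absolute values.
  refine ⟨⟨1280 * |B| / (power - ε) ^ 2, fun N m d P ρ hρ hB => ?_⟩, fun B' =>
    ⟨2 * ((6 * √(40 * |B|) + 4 * √|B'|) * √(40 * |B|)) / (power - ε),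
      fun N m d P ρ hρ hB hB' => ⟨fun hD => ?_, fun D hD => ?_⟩⟩⟩
  · have hne := hρ.nonempty_pureDecomposition
    refine ⟨fun M _ => ⟨_, P.signal_expansion_one hne.some M⟩,
      P.one_div_alphaMin_sq_le fun α hα h => ?_⟩
    refine le_apply_entanglementMF hne (g := fun E => 1280 * |B| / (power - ε) ^ 2 *
      (N + (N : ℝ) ^ 2 * √E) * α ^ 2) (by fun_prop) fun D => ?_
    exact h.one_le_of_one hεpower (abs_nonneg B) (hB.mono (le_abs_self B)) D hα
  · have hne := hρ.nonempty_pureDecomposition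
    refine ⟨P.effectIsSecondOrder (hD hne.some), P.one_div_alphaMin_sq_le fun α hα h => ?_⟩
    have hc : Continuous fun E : ℝ => E ^ (1 / 4 : ℝ) := Real.continuous_rpow_const (by norm_num)
    -- Approaching the infimum requires the bound for every decomposition, which is why the forward
    -- condition is assumed for all of them here.
    refine le_apply_entanglementMF hne (g := fun E =>
      2 * ((6 * √(40 * |B|) + 4 * √|B'|) * √(40 * |B|)) / (power - ε) *
      ((N : ℝ) ^ (3 / 2 : ℝ) + (N : ℝ) ^ 2 * E ^ (1 / 4 : ℝ)) * α ^ 2) (by fun_prop) fun D => ?_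
    exact h.one_le_of_two hεpower (abs_nonneg B) (hB.mono (le_abs_self B)) (abs_nonneg B')
      (hB'.mono (le_abs_self B')) (hD D)
  · refine ⟨P.effectIsSecondOrder hD, P.one_div_alphaMin_sq_le fun α _ h => ?_⟩
    exact h.one_le_of_two hεpower (abs_nonneg B) (hB.mono (le_abs_self B)) (abs_nonneg B')
      (hB'.mono (le_abs_self B')) hD
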